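/- Let $0<\alpha\le 1$, and let $E,A\in\mathbb R^{n\times n}$, $B\in\mathbb R^{n\times m}$, $C\in\mathbb R^{p\times n}$ with $\operatorname{rank}E=r<n$. Consider the singular fractional-order system $E\mathscr D^\alpha x=Ax+Bu$, $y=Cx$ (with $\mathscr D^\alpha$ the Caputo derivative of order $\alpha$) under the observer-based controller $$E\mathscr D^\alpha\hat x=A\hat x+Bu+L(C\hat x-y),\qquad u=K\hat x,$$ with gains $K\in\mathbb R^{m\times n}$ and $L\in\mathbb R^{n\times p}$. In the variables $\bar x=(x,\,x-\hat x)$ the closed loop is $$\bar E\mathscr D^\alpha\bar x=\bar A\bar x,\qquad \bar E=\begin{bmatrix}E&0\\0&E\end{bmatrix},\qquad \bar A=\begin{bmatrix}A+BK&-BK\\0&A+LC\end{bmatrix}.$$ A system $E\mathscr D^\alpha x=Ax$ is called admissible if the pair $\{E,A\}$ is regular ($\det(sE-A)\not\equiv0$), impulse-free ($\deg\det(sE-A)=\operatorname{rank}E$) and stable (every $\lambda\in\mathbb C$ with $\det(\lambda E-A)=0$ is nonzero and satisfies $|\arg\lambda|>\alpha\pi/2$). Write $\operatorname{sym}(M)=M+M^{\mathsf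 T}$, let $<0$ and $>0$ mean symmetric negative and positive definite, and let $$\mathbb P_\alpha^{n\times n}=\Big\{\sin\big(\tfrac{\alpha\pi}2\big)X+\cos\big(\tfrac{\alpha\pi}2\big)Y:\ X,Y\in\mathbb R^{n\times n},\ \begin{bmatrix}X&Y\\-Y&X\end{bmatrix}>0\Big\}.$$ Let $E_1\in\mathbb R^{n\times(n-r)}$ and $E_2\in\mathbb R^{(n-r)\times n}$ be any matrices of rank $n-r$ with $EE_1=0$ and $E_2E=0$. For $P_1,P_2\in\mathbb P_\alpha^{n\times n}$, $Q_1\in\mathbb R^{(n-r)\times n}$, $Q_2\in\mathbb R^{n\times(n-r)}$, $R_1\in\mathbb R^{m\times n}$ and $R_2\in\mathbb R^{n\times p}$ consider the inequalities $$\operatorname{sym}(AP_1E^{\mathsf T}+AE_1Q_1+BR_1)<0,\qquad \operatorname{sym}(E^{\mathsf T}P_2A+Q_2E_2A+R_2C)<0.\tag{$*$}$$ 1. There exist gains $K,L$ for which the closed-loop system is admissible if and only if there exist matrices $P_1,P_2,Q_1,Q_2,R_1,R_2$ as above that satisfy $(*)$. 2. For given gains $K,L$, the closed-loop system is admissible if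 and only if there exist matrices $P_1,P_2,Q_1,Q_2,R_1,R_2$ as above that satisfy $(*)$, for which $P_1E^{\mathsf T}+E_1Q_1$ and $E^{\mathsf T}P_2+Q_2E_2$ are invertible, and $$K=R_1(P_1E^{\mathsf T}+E_1Q_1)^{-1},\qquad L=(E^{\mathsf T}P_2+Q_2E_2)^{-1}R_2.$$ -/

import Mathlib

open Polynomial

noncomputable section

/-- `sym M = Mᵀ + M`. -/
def symPart {ι : Type*} (M : Matrix ι ι ℝ) : Matrix ι ι ℝ := M.transpose + M

/-- The real matrix `M` is symmetric negative definite, `M < 0`. -/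
def NegDef {ι : Type*} (M : Matrix ι ι ℝ) : Prop := (-M).PosDef

/-- The set `ℙ_α` of fractional order positive definite matrices: all
`sin (απ/2) X + cos (απ/2) Y` with `[X, Y; -Y, X]` (symmetric) positive definite. -/
def fracPosDef (α : ℝ) (ι : Type*) : Set (Matrix ι ι ℝ) :=
  {P | ∃ X Y : Matrix ι ι ℝ, (Matrix.fromBlocks X Y (-Y) X).PosDef ∧
    P = Real.sin (α * Real.pi / 2) • X + Real.cos (α * Real.pi / 2) • Y}

section Pencil

variable {ι : Type*} [Fintype ι] [DecidableEq ι]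

/-- The pair `{E, A}` is regular: `det (sE - A)` is not identically zero for `s ∈ ℂ`. -/
def PairRegular (E A : Matrix ι ι ℝ) : Prop :=
  ∃ s : ℂ, (s • E.map Complex.ofReal - A.map Complex.ofReal).det ≠ 0

/-- The polynomial `det (sE - A)` in the variable `s`. -/
def pencilDet (E A : Matrix ι ι ℝ) : ℝ[X] :=
  ((X : ℝ[X]) • E.map C - A.map C).det

/-- The pair `{E, A}` is impulse free: `deg (det (sE - A)) = rank E`. The zero polynomial has
degree `⊥` here, hence never qualifies. -/
def PairImpulseFree (E A : Matrix ι ι ℝ) : Prop :=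
  (pencilDet E A).degree = (E.rank : WithBot ℕ)

/-- The pair `{E, A}` is stable of order `α`: every `z ∈ ℂ` with `det (zE - A) = 0` satisfies
`|arg z| > απ/2`. As `Complex.arg 0 = 0`, the number `0` is not in this sector for `α > 0`. -/
def PairStable (α : ℝ) (E A : Matrix ι ι ℝ) : Prop :=
  ∀ z : ℂ, (z • E.map Complex.ofReal - A.map Complex.ofReal).det = 0 →
    α * Real.pi / 2 < |Complex.arg z|

/-- The system `E 𝒟^α x = A x` is admissible: regular, impulse free and stable. -/
def Admissible (α : ℝ) (E A : Matrix ι ι ℝ) : Prop :=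
  PairRegular E A ∧ PairImpulseFree E A ∧ PairStable α E A

end Pencil

/-- `Ē = [E, 0; 0, E]`, acting on `(x, x - x̂)`. -/
def augE {n : ℕ} (E : Matrix (Fin n) (Fin n) ℝ) :
    Matrix (Fin n ⊕ Fin n) (Fin n ⊕ Fin n) ℝ :=
  Matrix.fromBlocks E 0 0 E

/-- `Ā = [A + BK, -BK; 0, A + LC]`, the closed loop of the plant `E 𝒟^α x = A x + B u`, `y = C x`
with the observer `E 𝒟^α x̂ = A x̂ + B u + L (C x̂ - y)`, `u = K x̂`, in the variables
`(x, x - x̂)`. -/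
def augA {n m p : ℕ} (A : Matrix (Fin n) (Fin n) ℝ) (B : Matrix (Fin n) (Fin m) ℝ)
    (C : Matrix (Fin p) (Fin n) ℝ) (K : Matrix (Fin m) (Fin n) ℝ)
    (L : Matrix (Fin n) (Fin p) ℝ) : Matrix (Fin n ⊕ Fin n) (Fin n ⊕ Fin n) ℝ :=
  Matrix.fromBlocks (A + B * K) (-(B * K)) 0 (A + L * C)

end

/-! The closed-loop pencil is block triangular with diagonal blocks `zE - (A + BK)` and `zE - (A +
LC)`, so the closed loop is admissible exactly when both blocks are. The observer block is a
state-feedback block for the transposed matrices. What remains is a Lyapunov criterion: `{E, A}` is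
admissible iff, for some `P ∈ ℙ_α` and some `Q`, the matrix `A * T` with `T = P * Eᵀ + E₁ * Q` has
negative definite symmetric part.

Sufficiency (`admissible_of_form_neg`): a failure of impulse-freeness, or a zero of `det (zE - A)`
in the closed sector, yields left vectors on which the quadratic form of `A * T` cannot be negative.

Necessity (`Admissible.exists_form_neg`) is by duality. If no `A * T` works, Hahn–Banach separates
this convex set from the negative definite forms by a positive semidefinite `G ≠ 0`. Put `H = EᵀGE`
and `N = EᵀGA`. Testing `G` on nearly rank-one elements of `ℙ_α` places every generalized eigenvalue
`z` of `Nᵀ x = z H x` with `H x ≠ 0` in the closed sector, and `GEx` is a left null vector of `zE -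
A`, against stability. Impulse-freeness excludes `H = 0`, so such an eigenvalue exists.

For the gains, set `R = K * T`; the inequality itself makes `T` invertible. A solution of the
inequality with free `R` may have singular `T`; a small move of `Q` along the line towards `E₂`
repairs this. -/

section ObserverBasedControl

open scoped Matrix

/-! ### Definiteness in terms of quadratic forms -/

theorem Matrix.dotProduct_mulVec_comm_transpose {ι κ : Type*} [Fintype ι] [Fintype κ]
    (M : Matrix ι κ ℝ) (x : ι → ℝ) (y : κ → ℝ) :
    x ⬝ᵥ (M *ᵥ y) = y ⬝ᵥ (Mᵀ *ᵥ x) := by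
  rw [Matrix.mulVec_transpose, Matrix.dotProduct_mulVec, dotProduct_comm]

theorem negDef_symPart_iff {ι : Type*} [Fintype ι] {M : Matrix ι ι ℝ} :
    NegDef (symPart M) ↔ ∀ x : ι → ℝ, x ≠ 0 → x ⬝ᵥ (M *ᵥ x) < 0 := by
  have key : ∀ x : ι → ℝ, star x ⬝ᵥ ((-symPart M) *ᵥ x) = -2 * (x ⬝ᵥ (M *ᵥ x)) := by
    intro x
    rw [symPart, star_trivial, Matrix.neg_mulVec, dotProduct_neg, Matrix.add_mulVec,
      dotProduct_add, ← Matrix.dotProduct_mulVec_comm_transpose]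
    ring
  rw [NegDef, Matrix.posDef_iff_dotProduct_mulVec]
  constructor
  · intro h x hx
    have := h.2 hx
    rw [key] at this
    linarith
  · intro h
    refine ⟨?_, fun x hx ↦ ?_⟩
    · rw [Matrix.IsHermitian, Matrix.conjTranspose_eq_transpose_of_trivial, symPart]
      simp [add_comm]
    · rw [key]
      linarith [h x hx]

/-- The form on the right is that of the Hermitian matrix `X - iY` at `u + iv`; skewness of `Y`
merges the two off-diagonal terms. -/
theorem posDef_fromBlocks_skew_iff {ι : Type*} [Fintype ι] {X Y : Matrix ι ι ℝ} :
    (Matrix.fromBlocks X Y (-Y) X).PosDef ↔ Xᵀ = X ∧ Yᵀ = -Y ∧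
      ∀ u v : ι → ℝ, (u ≠ 0 ∨ v ≠ 0) →
        0 < u ⬝ᵥ (X *ᵥ u) + v ⬝ᵥ (X *ᵥ v) + 2 * (u ⬝ᵥ (Y *ᵥ v)) := by
  rw [Matrix.posDef_iff_dotProduct_mulVec, Matrix.IsHermitian,
    Matrix.conjTranspose_eq_transpose_of_trivial, Matrix.fromBlocks_transpose,
    Matrix.fromBlocks_inj, Matrix.transpose_neg]
  have key : Yᵀ = -Y → ∀ u v : ι → ℝ, star (Sum.elim u v) ⬝ᵥ
      (Matrix.fromBlocks X Y (-Y) X *ᵥ Sum.elim u v) =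
        u ⬝ᵥ (X *ᵥ u) + v ⬝ᵥ (X *ᵥ v) + 2 * (u ⬝ᵥ (Y *ᵥ v)) := by
    intro hY u v
    have h : v ⬝ᵥ (Y *ᵥ u) = -(u ⬝ᵥ (Y *ᵥ v)) := by
      rw [Matrix.dotProduct_mulVec_comm_transpose, hY, Matrix.neg_mulVec, dotProduct_neg]
    rw [star_trivial, Matrix.fromBlocks_mulVec, sumElim_dotProduct_sumElim]
    simp only [Sum.elim_comp_inl, Sum.elim_comp_inr, dotProduct_add, Matrix.neg_mulVec,
      dotProduct_neg, h]
    ring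
  have hne : ∀ u v : ι → ℝ, Sum.elim u v ≠ 0 ↔ (u ≠ 0 ∨ v ≠ 0) := by
    intro u v
    rw [← not_and_or, not_iff_not]
    constructor
    · intro h
      exact ⟨funext fun i ↦ congrFun h (Sum.inl i), funext fun i ↦ congrFun h (Sum.inr i)⟩
    · rintro ⟨rfl, rfl⟩
      ext (i | i) <;> rfl
  constructor
  · rintro ⟨⟨hX, hY, hY', -⟩, h⟩
    refine ⟨hX, hY', fun u v huv ↦ ?_⟩
    rw [← key hY']
    exact h ((hne u v).2 huv)
  · rintro ⟨hX, hY, h⟩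
    refine ⟨⟨hX, by rw [hY, neg_neg], hY, hX⟩, fun x hx ↦ ?_⟩
    obtain ⟨u, v, rfl⟩ : ∃ u v, x = Sum.elim u v :=
      ⟨x ∘ Sum.inl, x ∘ Sum.inr, (Sum.elim_comp_inl_inr x).symm⟩
    rw [key hY]
    exact h u v ((hne u v).1 hx)

/-! ### The closed sector -/

section Sector

variable {α : ℝ}

theorem sin_order_pos (h0 : 0 < α) (h1 : α ≤ 1) : 0 < Real.sin (α * Real.pi / 2) := by
  have := Real.pi_pos
  exact Real.sin_pos_of_pos_of_lt_pi (by positivity) (by nlinarith)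

theorem cos_order_nonneg (h0 : 0 < α) (h1 : α ≤ 1) : 0 ≤ Real.cos (α * Real.pi / 2) := by
  have := Real.pi_pos
  exact Real.cos_nonneg_of_neg_pi_div_two_le_of_le (by nlinarith) (by nlinarith)

/-- The closed sector `|arg z| ≤ απ/2` as an intersection of two half-planes. -/
theorem abs_arg_le_iff (h0 : 0 < α) (h1 : α ≤ 1) (z : ℂ) :
    |Complex.arg z| ≤ α * Real.pi / 2 ↔
      Real.cos (α * Real.pi / 2) * |z.im| ≤ Real.sin (α * Real.pi / 2) * z.re := by
  have hpi := Real.pi_pos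
  rcases eq_or_ne z 0 with rfl | hz
  · simp; positivity
  have hn : 0 < ‖z‖ := norm_pos_iff.2 hz
  have hre : z.re = ‖z‖ * Real.cos |z.arg| := by
    rw [Real.cos_abs, Complex.norm_mul_cos_arg]
  have him : |z.im| = ‖z‖ * Real.sin |z.arg| := by
    rw [← Complex.norm_mul_sin_arg z, abs_mul, abs_norm,
      Real.abs_sin_eq_sin_abs_of_abs_le_pi (Complex.abs_arg_le_pi z)]
  have h2 : |z.arg| ≤ Real.pi := Complex.abs_arg_le_pi z
  have h3 : 0 ≤ |z.arg| := abs_nonneg _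
  have key : Real.sin (α * Real.pi / 2) * z.re - Real.cos (α * Real.pi / 2) * |z.im| =
      ‖z‖ * Real.sin (α * Real.pi / 2 - |z.arg|) := by
    rw [hre, him, Real.sin_sub]; ring
  constructor
  · intro h
    have : 0 ≤ Real.sin (α * Real.pi / 2 - |z.arg|) :=
      Real.sin_nonneg_of_nonneg_of_le_pi (by linarith) (by nlinarith)
    nlinarith [mul_nonneg hn.le this]
  · intro h
    by_contra! hlt
    have : Real.sin (α * Real.pi / 2 - |z.arg|) < 0 :=
      Real.sin_neg_of_neg_of_neg_pi_lt (by linarith) (by nlinarith)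
    nlinarith [mul_neg_of_pos_of_neg hn this]

end Sector

/-! ### The set `ℙ_α` -/

section FracPosDef

variable {ι : Type*} {α : ℝ}

theorem fracPosDef_transpose [Fintype ι] {P : Matrix ι ι ℝ} (hP : P ∈ fracPosDef α ι) :
    Pᵀ ∈ fracPosDef α ι := by
  obtain ⟨X, Y, h, rfl⟩ := hP
  rw [posDef_fromBlocks_skew_iff] at h
  obtain ⟨hX, hY, h⟩ := h
  refine ⟨X, -Y, posDef_fromBlocks_skew_iff.2 ⟨hX, by rw [Matrix.transpose_neg, hY], ?_⟩, ?_⟩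
  · intro u v huv
    have := h u (-v) (by simpa using huv)
    simpa [Matrix.neg_mulVec, Matrix.mulVec_neg] using this
  · rw [Matrix.transpose_add, Matrix.transpose_smul, Matrix.transpose_smul, hX, hY]

theorem convex_fracPosDef [Fintype ι] : Convex ℝ (fracPosDef α ι) := by
  rintro _ ⟨X, Y, h, rfl⟩ _ ⟨X', Y', h', rfl⟩ a b ha hb hab
  refine ⟨a • X + b • X', a • Y + b • Y', ?_, by module⟩
  have : Matrix.fromBlocks (a • X + b • X') (a • Y + b • Y') (-(a • Y + b • Y'))
      (a • X + b • X') = a • Matrix.fromBlocks X Y (-Y) X + b • Matrix.fromBlocks X' Y' (-Y') X' := by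
    rw [Matrix.fromBlocks_smul, Matrix.fromBlocks_smul, Matrix.fromBlocks_add]
    congr 1
    module
  rw [this]
  rcases ha.eq_or_lt with rfl | ha
  · obtain rfl : b = 1 := by linarith
    simpa using h'
  rcases hb.eq_or_lt with rfl | hb
  · obtain rfl : a = 1 := by linarith
    simpa using h
  exact (h.smul ha).add (h'.smul hb)

/-- Here `X - iY = ww* + ε` with `w = a - ib`. These are the test elements on which a separating
functional is evaluated; `ε` makes the form strict and later tends to `0`. -/
theorem rankOne_add_smul_one_mem_fracPosDef [Fintype ι] [DecidableEq ι] (a b : ι → ℝ) {ε : ℝ}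
    (hε : 0 < ε) :
    Real.sin (α * Real.pi / 2) • (Matrix.vecMulVec a a + Matrix.vecMulVec b b + ε • 1) +
      Real.cos (α * Real.pi / 2) • (Matrix.vecMulVec b a - Matrix.vecMulVec a b) ∈
        fracPosDef α ι := by
  refine ⟨_, _, posDef_fromBlocks_skew_iff.2 ⟨?_, ?_, ?_⟩, rfl⟩
  · simp [Matrix.transpose_vecMulVec]
  · simp [Matrix.transpose_vecMulVec]
  · intro u v huv
    have hpos : 0 < u ⬝ᵥ u + v ⬝ᵥ v := by
      have hu := dotProduct_self_star_nonneg u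
      have hv := dotProduct_self_star_nonneg v
      rw [star_trivial] at hu hv
      rcases huv with h | h
      · have := lt_of_le_of_ne hu (fun h' ↦ h (dotProduct_self_eq_zero.1 h'.symm)); linarith
      · have := lt_of_le_of_ne hv (fun h' ↦ h (dotProduct_self_eq_zero.1 h'.symm)); linarith
    simp only [Matrix.add_mulVec, Matrix.sub_mulVec, Matrix.vecMulVec_mulVec, Matrix.smul_mulVec,
      Matrix.one_mulVec, dotProduct_add, dotProduct_sub, dotProduct_smul, smul_eq_mul,
      op_smul_eq_smul]
    rw [dotProduct_comm a u, dotProduct_comm b u, dotProduct_comm a v, dotProduct_comm b v]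
    -- The form equals the sum of the two listed squares plus `ε (u ⬝ᵥ u + v ⬝ᵥ v)`.
    nlinarith [mul_pos hε hpos, sq_nonneg (u ⬝ᵥ b + v ⬝ᵥ a), sq_nonneg (u ⬝ᵥ a - v ⬝ᵥ b)]

/-- For `z = σ + iτ` in the closed sector and `w = u + iv`, the real part of `z * (w* P w)` is
nonnegative. -/
theorem sector_form_nonneg [Fintype ι] (h0 : 0 < α) (h1 : α ≤ 1) {P : Matrix ι ι ℝ}
    (hP : P ∈ fracPosDef α ι) {σ τ : ℝ}
    (hz : Real.cos (α * Real.pi / 2) * |τ| ≤ Real.sin (α * Real.pi / 2) * σ) (u v : ι → ℝ) :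
    0 ≤ σ * (u ⬝ᵥ (P *ᵥ u) + v ⬝ᵥ (P *ᵥ v)) + τ * (u ⬝ᵥ (P *ᵥ v) - v ⬝ᵥ (P *ᵥ u)) := by
  by_cases huv : u ≠ 0 ∨ v ≠ 0
  swap
  · push Not at huv
    simp [huv.1, huv.2]
  obtain ⟨X, Y, h, rfl⟩ := hP
  obtain ⟨hX, hY, h⟩ := posDef_fromBlocks_skew_iff.1 h
  have p1 := h u v huv
  -- Positivity at both `(u, v)` and `(u, -v)` bounds `|2 u ⬝ᵥ Y v|` by the `X`-terms; multiplied by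
  -- the sector inequality, this controls the `τ`-term.
  have p2 := h u (-v) (by simpa using huv)
  simp only [Matrix.mulVec_neg, dotProduct_neg, neg_dotProduct, neg_neg] at p2
  have hskew : ∀ x y : ι → ℝ, x ⬝ᵥ (Y *ᵥ y) = -(y ⬝ᵥ (Y *ᵥ x)) := fun x y ↦ by
    rw [Matrix.dotProduct_mulVec_comm_transpose, hY, Matrix.neg_mulVec, dotProduct_neg]
  have hXs : v ⬝ᵥ (X *ᵥ u) = u ⬝ᵥ (X *ᵥ v) := by
    rw [Matrix.dotProduct_mulVec_comm_transpose, hX]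
  have e1 : u ⬝ᵥ (Y *ᵥ u) = 0 := by linarith [hskew u u]
  have e2 : v ⬝ᵥ (Y *ᵥ v) = 0 := by linarith [hskew v v]
  have e3 : v ⬝ᵥ (Y *ᵥ u) = -(u ⬝ᵥ (Y *ᵥ v)) := hskew v u
  have hs := sin_order_pos h0 h1
  have hc := cos_order_nonneg h0 h1
  simp only [Matrix.add_mulVec, Matrix.smul_mulVec, dotProduct_add, dotProduct_smul, smul_eq_mul,
    hXs, e1, e2, e3]
  generalize u ⬝ᵥ (X *ᵥ u) = x at *
  generalize v ⬝ᵥ (X *ᵥ v) = x' at *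
  generalize u ⬝ᵥ (Y *ᵥ v) = y at *
  generalize Real.sin (α * Real.pi / 2) = s at *
  generalize Real.cos (α * Real.pi / 2) = c at *
  have hy : |2 * y| ≤ x + x' := abs_le.2 ⟨by linarith, by linarith⟩
  have h3 : c * |τ| * |2 * y| ≤ s * σ * (x + x') :=
    mul_le_mul hz hy (abs_nonneg _) ((mul_nonneg hc (abs_nonneg _)).trans hz)
  have h4 : c * (-(τ * (2 * y))) ≤ c * (|τ| * |2 * y|) := by
    refine mul_le_mul_of_nonneg_left ?_ hc
    rw [← abs_mul]
    exact neg_le_abs _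
  nlinarith

theorem fracPosDef_form_pos [Fintype ι] (h0 : 0 < α) (h1 : α ≤ 1) {P : Matrix ι ι ℝ}
    (hP : P ∈ fracPosDef α ι) {u : ι → ℝ} (hu : u ≠ 0) : 0 < u ⬝ᵥ (P *ᵥ u) := by
  obtain ⟨X, Y, h, rfl⟩ := hP
  obtain ⟨hX, hY, h⟩ := posDef_fromBlocks_skew_iff.1 h
  have p := h u 0 (Or.inl hu)
  have e : u ⬝ᵥ (Y *ᵥ u) = -(u ⬝ᵥ (Y *ᵥ u)) := by
    conv_lhs => rw [Matrix.dotProduct_mulVec_comm_transpose, hY, Matrix.neg_mulVec, dotProduct_neg]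
  have e1 : u ⬝ᵥ (Y *ᵥ u) = 0 := by linarith
  simp only [Matrix.mulVec_zero, dotProduct_zero, mul_zero, add_zero] at p
  simp only [Matrix.add_mulVec, Matrix.smul_mulVec, dotProduct_add, dotProduct_smul, smul_eq_mul,
    e1, mul_zero, add_zero]
  exact mul_pos (sin_order_pos h0 h1) p

end FracPosDef

/-! ### Degree and null vectors of the pencil -/

section Pencil

variable {ι : Type*} [Fintype ι] [DecidableEq ι]

/-- After a change of basis adapted to `ker E` and multiplication of the columns belonging to
`ker E` by `X`, the pencil `XE - A` becomes a pencil `X M₀ + M₁` of which the leading coefficient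
`M₀` detects impulses. -/
theorem exists_pencil_normalization (E A : Matrix ι ι ℝ) :
    ∃ (M₀ M₁ : Matrix ι ι ℝ) (c : ℝ), c ≠ 0 ∧
      pencilDet E A * C c * X ^ (Fintype.card ι - E.rank) =
        ((X : ℝ[X]) • M₀.map C + M₁.map C).det ∧
      ∀ g : ι → ℝ, g ᵥ* M₀ = 0 ↔
        (g ᵥ* E = 0 ∧ ∀ x : ι → ℝ, E *ᵥ x = 0 → g ⬝ᵥ (A *ᵥ x) = 0) := by
  obtain ⟨V, U, e, hV, hU, h⟩ := Matrix.exists_rank_normal_form E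
  have hVd : IsUnit V.det := (Matrix.isUnit_iff_isUnit_det V).1 hV
  have hUd : IsUnit U.det := (Matrix.isUnit_iff_isUnit_det U).1 hU
  have hEU : E * U = V⁻¹ * (Matrix.fromBlocks (1 : Matrix (Fin E.rank) (Fin E.rank) ℝ) 0 0
      (0 : Matrix (Fin (Fintype.card ι - E.rank)) (Fin (Fintype.card ι - E.rank)) ℝ)).submatrix
        e e := by
    rw [← h, Matrix.mul_assoc V, Matrix.nonsing_inv_mul_cancel_left _ _ hVd]
  have hzero : ∀ i j k, e j = Sum.inr k → (E * U) i j = 0 := by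
    intro i j k hj
    rw [hEU, Matrix.mul_apply]
    refine Finset.sum_eq_zero fun l _ ↦ ?_
    rw [Matrix.submatrix_apply, hj]
    rcases e l with l' | l' <;> simp
  -- The `inr` columns of `E * U` vanish, so in `XE - A` times `U` they are constant; multiplying
  -- them by `X` moves `-(A * U)` into the leading coefficient.
  let d : ι → ℝ[X] := fun j ↦ Sum.elim (fun _ ↦ 1) (fun _ ↦ X) (e j)
  let M₀ : Matrix ι ι ℝ :=
    Matrix.of fun i j ↦ Sum.elim (fun _ ↦ (E * U) i j) (fun _ ↦ -(A * U) i j) (e j)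
  let M₁ : Matrix ι ι ℝ :=
    Matrix.of fun i j ↦ Sum.elim (fun _ ↦ -(A * U) i j) (fun _ ↦ 0) (e j)
  refine ⟨M₀, M₁, U.det, hUd.ne_zero, ?_, fun g ↦ ?_⟩
  · have hd : (Matrix.diagonal d).det = X ^ (Fintype.card ι - E.rank) := by
      rw [Matrix.det_diagonal]
      have : ∏ j, d j = ∏ j, (Sum.elim (fun _ ↦ 1) (fun _ ↦ X) : _ ⊕ _ → ℝ[X]) j :=
        Equiv.prod_comp e (Sum.elim (fun _ ↦ 1) (fun _ ↦ X))
      rw [this, Fintype.prod_sum_type]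
      simp
    have hU' : (U.map C).det = C U.det := by
      rw [← RingHom.mapMatrix_apply, ← RingHom.map_det]
    rw [pencilDet, ← hd, ← hU', ← Matrix.det_mul, ← Matrix.det_mul]
    congr 1
    rw [Matrix.sub_mul, Matrix.smul_mul, ← Matrix.map_mul, ← Matrix.map_mul]
    ext1 i j
    rw [Matrix.mul_diagonal]
    simp only [Matrix.sub_apply, Matrix.add_apply, Matrix.smul_apply, Matrix.map_apply, d, M₀, M₁,
      Matrix.of_apply, smul_eq_mul]
    rcases hj : e j with k | k
    · simp [sub_eq_add_neg]
    · simp only [hzero i j k hj, Sum.elim_inr, C_0, mul_zero, zero_sub, add_zero, C_neg]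
      ring
  · have hcolE : ∀ j k, e j = Sum.inl k → (g ᵥ* M₀) j = (g ᵥ* (E * U)) j := by
      intro j k hj
      simp only [Matrix.vecMul, dotProduct, M₀, Matrix.of_apply, hj, Sum.elim_inl]
    have hcolA : ∀ j k, e j = Sum.inr k → (g ᵥ* M₀) j = -(g ᵥ* (A * U)) j := by
      intro j k hj
      simp only [Matrix.vecMul, dotProduct, M₀, Matrix.of_apply, hj, Sum.elim_inr, mul_neg,
        Finset.sum_neg_distrib]
    constructor
    · intro hg
      constructor
      · have : g ᵥ* (E * U) = 0 := by
          ext j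
          rcases hj : e j with k | k
          · rw [← hcolE j k hj, hg]
          · simp only [Matrix.vecMul, dotProduct, hzero _ j k hj, mul_zero, Finset.sum_const_zero,
              Pi.zero_apply]
        rw [← Matrix.vecMul_vecMul] at this
        calc g ᵥ* E = (g ᵥ* E) ᵥ* U ᵥ* U⁻¹ := by
              rw [Matrix.vecMul_vecMul _ U, Matrix.mul_nonsing_inv _ hUd, Matrix.vecMul_one]
          _ = 0 := by rw [this, Matrix.zero_vecMul]
      · intro x hx
        have hxU : x = U *ᵥ (U⁻¹ *ᵥ x) := by
          rw [Matrix.mulVec_mulVec, Matrix.mul_nonsing_inv _ hUd, Matrix.one_mulVec]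
        have h0 : (V * E * U) *ᵥ (U⁻¹ *ᵥ x) = 0 := by
          rw [← Matrix.mulVec_mulVec, ← hxU, ← Matrix.mulVec_mulVec, hx, Matrix.mulVec_zero]
        generalize U⁻¹ *ᵥ x = y at hxU h0
        rw [hxU, Matrix.mulVec_mulVec, Matrix.dotProduct_mulVec]
        refine Finset.sum_eq_zero fun j _ ↦ ?_
        rcases hj : e j with k | k
        · have := congrFun h0 j
          rw [h, Matrix.submatrix_mulVec_equiv, Function.comp_apply, hj,
            Matrix.fromBlocks_mulVec] at this
          rw [Sum.elim_inl, Matrix.one_mulVec, Matrix.zero_mulVec, add_zero, Function.comp_apply,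
            Function.comp_apply, ← hj, Equiv.symm_apply_apply, Pi.zero_apply] at this
          rw [this, mul_zero]
        · have := hcolA j k hj
          rw [hg, Pi.zero_apply] at this
          rw [neg_eq_zero.1 this.symm, zero_mul]
    · rintro ⟨hgE, hgA⟩
      ext j
      rcases hj : e j with k | k
      · rw [hcolE j k hj, ← Matrix.vecMul_vecMul, hgE, Matrix.zero_vecMul]
      · rw [hcolA j k hj]
        have hx := hgA (U *ᵥ Pi.single j 1) (by
          rw [Matrix.mulVec_mulVec, Matrix.mulVec_single_one]
          ext i
          exact hzero i j k hj)
        rw [Matrix.mulVec_mulVec, Matrix.dotProduct_mulVec, dotProduct_single_one] at hx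
        rw [hx, neg_zero, Pi.zero_apply]

/-- The normalized determinant has degree at most `card ι`, and the factor `X ^ (card ι - rank E)`
accounts for the excess over the rank. -/
theorem natDegree_pencilDet_le_rank (E A : Matrix ι ι ℝ) :
    (pencilDet E A).natDegree ≤ E.rank := by
  obtain ⟨M₀, M₁, c, hc, h, -⟩ := exists_pencil_normalization E A
  rcases eq_or_ne (pencilDet E A) 0 with h0 | h0
  · simp [h0]
  have h1 := Polynomial.natDegree_det_X_add_C_le M₀ M₁
  rw [← h, natDegree_mul_X_pow _ (mul_ne_zero h0 (C_ne_zero.2 hc)), natDegree_mul_C hc] at h1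
  have := Matrix.rank_le_card_width E
  omega

/-- Up to a nonzero constant, the coefficient at `rank E` is `det M₀`, so impulse-freeness says that
`M₀` has no nonzero left null vector. -/
theorem pairImpulseFree_iff {E A : Matrix ι ι ℝ} :
    PairImpulseFree E A ↔ ∀ g : ι → ℝ, g ᵥ* E = 0 →
      (∀ x : ι → ℝ, E *ᵥ x = 0 → g ⬝ᵥ (A *ᵥ x) = 0) → g = 0 := by
  obtain ⟨M₀, M₁, c, hc, h, hM⟩ := exists_pencil_normalization E A
  have hcoeff : (pencilDet E A).coeff E.rank * c = M₀.det := by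
    have hr := Matrix.rank_le_card_width E
    rw [← Polynomial.coeff_det_X_add_C_card M₀ M₁, ← h]
    conv_rhs => rw [← Nat.add_sub_of_le hr, Nat.add_sub_cancel_left, coeff_mul_X_pow, coeff_mul_C]
  have h1 : PairImpulseFree E A ↔ (pencilDet E A).coeff E.rank ≠ 0 := by
    constructor
    · intro h
      exact coeff_ne_zero_of_eq_degree h
    · intro h
      exact degree_eq_of_le_of_coeff_ne_zero
        (natDegree_le_iff_degree_le.1 (natDegree_pencilDet_le_rank E A)) h
  have h2 : (pencilDet E A).coeff E.rank ≠ 0 ↔ M₀.det ≠ 0 := by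
    rw [← hcoeff]
    simp [hc]
  rw [h1, h2, ne_eq, ← Matrix.exists_vecMul_eq_zero_iff]
  push Not
  refine forall_congr' fun g ↦ ?_
  rw [ne_eq, ne_eq, hM]
  tauto

theorem PairImpulseFree.pairRegular {E A : Matrix ι ι ℝ} (h : PairImpulseFree E A) :
    PairRegular E A := by
  have h0 : pencilDet E A ≠ 0 := by
    intro h0
    rw [PairImpulseFree, h0, degree_zero] at h
    exact WithBot.bot_ne_coe h
  obtain ⟨s, hs⟩ := Polynomial.exists_eval_ne_zero_of_natDegree_lt_card (pencilDet E A) h0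
    (by rw [Cardinal.mk_real]; exact Cardinal.natCast_lt_aleph0.trans_le Cardinal.aleph0_le_continuum)
  refine ⟨s, ?_⟩
  have e1 : (s : ℂ) • E.map Complex.ofReal - A.map Complex.ofReal =
      Complex.ofRealHom.mapMatrix (s • E - A) := by
    ext i j
    simp
  have e2 : (s • E - A).det = (pencilDet E A).eval s := by
    rw [pencilDet, ← Polynomial.coe_evalRingHom, RingHom.map_det]
    congr 1
    ext i j
    simp only [RingHom.mapMatrix_apply, Matrix.map_apply, Matrix.sub_apply, Matrix.smul_apply,
      smul_eq_mul, coe_evalRingHom, eval_sub, eval_mul, eval_X, eval_C]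
  rw [e1, ← RingHom.map_det, e2]
  simpa using hs

theorem pencilDet_transpose (E A : Matrix ι ι ℝ) : pencilDet Eᵀ Aᵀ = pencilDet E A := by
  rw [pencilDet, pencilDet, ← Matrix.det_transpose]
  rfl

/-- This duality turns the observer problem into a state-feedback problem. -/
theorem Admissible.transpose {α : ℝ} {E A : Matrix ι ι ℝ} (h : Admissible α E A) :
    Admissible α Eᵀ Aᵀ := by
  have hdet : ∀ z : ℂ, (z • Eᵀ.map Complex.ofReal - Aᵀ.map Complex.ofReal).det =
      (z • E.map Complex.ofReal - A.map Complex.ofReal).det := fun z ↦ by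
    rw [← Matrix.det_transpose]
    rfl
  refine ⟨?_, ?_, ?_⟩
  · simpa only [PairRegular, hdet] using h.1
  · rw [PairImpulseFree, pencilDet_transpose, Matrix.rank_transpose]
    exact h.2.1
  · simpa only [PairStable, hdet] using h.2.2

theorem admissible_transpose_iff {α : ℝ} {E A : Matrix ι ι ℝ} :
    Admissible α Eᵀ Aᵀ ↔ Admissible α E A :=
  ⟨fun h ↦ by simpa using h.transpose, Admissible.transpose⟩

/-- Left null vectors `g + ih` of `zE - A`, written with real matrices. -/
theorem det_pencil_eq_zero_iff (E A : Matrix ι ι ℝ) (z : ℂ) :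
    (z • E.map Complex.ofReal - A.map Complex.ofReal).det = 0 ↔
      ∃ g h : ι → ℝ, (g ≠ 0 ∨ h ≠ 0) ∧
        Aᵀ *ᵥ g = z.re • (Eᵀ *ᵥ g) - z.im • (Eᵀ *ᵥ h) ∧
        Aᵀ *ᵥ h = z.im • (Eᵀ *ᵥ g) + z.re • (Eᵀ *ᵥ h) := by
  have hre : ∀ (w : ι → ℂ) j, ((w ᵥ* (z • E.map Complex.ofReal - A.map Complex.ofReal)) j).re =
      (z.re • (Eᵀ *ᵥ fun i ↦ (w i).re) - z.im • (Eᵀ *ᵥ fun i ↦ (w i).im) -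
        Aᵀ *ᵥ fun i ↦ (w i).re) j := by
    intro w j
    simp only [Matrix.vecMul, Matrix.mulVec, dotProduct, Matrix.sub_apply, Matrix.smul_apply,
      Matrix.map_apply, Matrix.transpose_apply, Pi.sub_apply, Pi.smul_apply, smul_eq_mul,
      Complex.re_sum, Finset.mul_sum, ← Finset.sum_sub_distrib]
    refine Finset.sum_congr rfl fun i _ ↦ ?_
    simp
    ring
  have him : ∀ (w : ι → ℂ) j, ((w ᵥ* (z • E.map Complex.ofReal - A.map Complex.ofReal)) j).im =
      (z.im • (Eᵀ *ᵥ fun i ↦ (w i).re) + z.re • (Eᵀ *ᵥ fun i ↦ (w i).im) -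
        Aᵀ *ᵥ fun i ↦ (w i).im) j := by
    intro w j
    simp only [Matrix.vecMul, Matrix.mulVec, dotProduct, Matrix.sub_apply, Matrix.smul_apply,
      Matrix.map_apply, Matrix.transpose_apply, Pi.sub_apply, Pi.add_apply, Pi.smul_apply,
      smul_eq_mul, Complex.im_sum, Finset.mul_sum, ← Finset.sum_sub_distrib,
      ← Finset.sum_add_distrib]
    refine Finset.sum_congr rfl fun i _ ↦ ?_
    simp
    ring
  rw [← Matrix.exists_vecMul_eq_zero_iff]
  constructor
  · rintro ⟨w, hw, h⟩
    refine ⟨fun i ↦ (w i).re, fun i ↦ (w i).im, ?_, ?_, ?_⟩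
    · by_contra! h'
      exact hw (_root_.funext fun i ↦ Complex.ext (congrFun h'.1 i) (congrFun h'.2 i))
    · refine (sub_eq_zero.1 (_root_.funext fun j ↦ ?_)).symm
      rw [← hre, h]
      rfl
    · refine (sub_eq_zero.1 (_root_.funext fun j ↦ ?_)).symm
      rw [← him, h]
      rfl
  · rintro ⟨g, h, hgh, h1, h2⟩
    refine ⟨fun i ↦ ⟨g i, h i⟩, ?_, _root_.funext fun j ↦ Complex.ext ?_ ?_⟩
    · intro h0
      rcases hgh with hg | hg
      · exact hg (_root_.funext fun i ↦ congrArg Complex.re (congrFun h0 i))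
      · exact hg (_root_.funext fun i ↦ congrArg Complex.im (congrFun h0 i))
    · rw [hre]
      simp [h1]
    · rw [him]
      simp [h2]

end Pencil

/-! ### Kernels and ranks -/

theorem Matrix.exists_mulVec_eq_of_mulVec_eq_zero {κ ι ι' : Type*} [Fintype κ]
    [Fintype ι] [Fintype ι'] {E : Matrix κ ι ℝ} {F : Matrix ι ι' ℝ} (hEF : E * F = 0)
    (hr : E.rank + F.rank = Fintype.card ι) {x : ι → ℝ} (hx : E *ᵥ x = 0) :
    ∃ y, F *ᵥ y = x := by
  have hle : LinearMap.range F.mulVecLin ≤ LinearMap.ker E.mulVecLin := by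
    rintro _ ⟨y, rfl⟩
    simp [hEF]
  have heq := Submodule.eq_of_le_of_finrank_eq hle (by
    have := LinearMap.finrank_range_add_finrank_ker E.mulVecLin
    rw [Module.finrank_fintype_fun_eq_card] at this
    simp only [Matrix.rank] at hr
    omega)
  have : x ∈ LinearMap.range F.mulVecLin := by
    rw [heq]
    simpa using hx
  exact this

theorem Matrix.rank_fromBlocks_zero_zero {ι κ ι' κ' : Type*} [Fintype ι] [Fintype κ] [Fintype ι']
    [Fintype κ'] (M : Matrix ι κ ℝ) (N : Matrix ι' κ' ℝ) :
    (Matrix.fromBlocks M 0 0 N).rank = M.rank + N.rank := by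
  have hcomp : ((LinearEquiv.sumArrowLequivProdArrow ι ι' ℝ ℝ) : _ →ₗ[ℝ] _) ∘ₗ
      (Matrix.fromBlocks M 0 0 N).mulVecLin =
      (M.mulVecLin.prodMap N.mulVecLin) ∘ₗ
        ((LinearEquiv.sumArrowLequivProdArrow κ κ' ℝ ℝ) : _ →ₗ[ℝ] _) := by
    ext1 x
    ext i <;> simp [Matrix.fromBlocks_mulVec, Function.comp_def] <;> rfl
  have h1 : LinearMap.range (M.mulVecLin.prodMap N.mulVecLin) =
      (LinearMap.range (Matrix.fromBlocks M 0 0 N).mulVecLin).map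
        ((LinearEquiv.sumArrowLequivProdArrow ι ι' ℝ ℝ) : _ →ₗ[ℝ] _) := by
    rw [← LinearMap.range_comp, hcomp, LinearMap.range_comp_of_range_eq_top _ (LinearEquiv.range _)]
  rw [Matrix.rank, ← LinearEquiv.finrank_map_eq (LinearEquiv.sumArrowLequivProdArrow ι ι' ℝ ℝ), ← h1,
    LinearMap.range_prodMap, Matrix.rank, Matrix.rank, ← Module.finrank_prod (R := ℝ)]
  have h2 : Function.Injective ((LinearMap.range M.mulVecLin).subtype.prodMap
      (LinearMap.range N.mulVecLin).subtype) :=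
    Function.Injective.prodMap (Submodule.subtype_injective _) (Submodule.subtype_injective _)
  rw [← LinearMap.finrank_range_of_inj h2, LinearMap.range_prodMap, Submodule.range_subtype,
    Submodule.range_subtype]

/-! ### Separation from the negative definite forms -/

section Separation

variable {ι : Type*} [Fintype ι]

/-- By homogeneity the condition need only be checked on the unit sphere, and compactness makes it
stable. -/
theorem isOpen_setOf_form_neg :
    IsOpen {M : Matrix ι ι ℝ | ∀ x : ι → ℝ, x ≠ 0 → x ⬝ᵥ (M *ᵥ x) < 0} := by
  rw [isOpen_iff_mem_nhds]
  intro M hM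
  have hcont : Continuous fun z : Matrix ι ι ℝ × (ι → ℝ) ↦ z.2 ⬝ᵥ (z.1 *ᵥ z.2) :=
    continuous_snd.dotProduct (continuous_fst.matrix_mulVec continuous_snd)
  have h := (isCompact_sphere (0 : ι → ℝ) 1).eventually_forall_of_forall_eventually
    (x₀ := M) (P := fun M x ↦ x ⬝ᵥ (M *ᵥ x) < 0) fun x hx ↦
      hcont.continuousAt.eventually_lt_const (hM x (ne_zero_of_mem_unit_sphere ⟨x, hx⟩))
  filter_upwards [h] with M' hM' x hx
  have hn : 0 < ‖x‖ := norm_pos_iff.2 hx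
  have := hM' (‖x‖⁻¹ • x) (by simp [norm_smul, hn.ne'])
  rw [Matrix.mulVec_smul, dotProduct_smul, smul_dotProduct, smul_eq_mul, smul_eq_mul,
    ← mul_assoc] at this
  have h2 : 0 < ‖x‖⁻¹ * ‖x‖⁻¹ := by positivity
  by_contra! h3
  exact absurd this (not_lt.2 (mul_nonneg h2.le h3))

theorem convex_setOf_form_neg :
    Convex ℝ {M : Matrix ι ι ℝ | ∀ x : ι → ℝ, x ≠ 0 → x ⬝ᵥ (M *ᵥ x) < 0} := by
  intro M hM N hN a b ha hb hab x hx
  have h1 := hM x hx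
  have h2 := hN x hx
  simp only [Matrix.add_mulVec, Matrix.smul_mulVec, dotProduct_add, dotProduct_smul, smul_eq_mul]
  rcases ha.eq_or_lt with rfl | ha
  · obtain rfl : b = 1 := by linarith
    simpa using h2
  · nlinarith

theorem nonneg_of_forall_pos_add_mul {a b : ℝ} (h : ∀ ε > 0, 0 ≤ a + ε * b) : 0 ≤ a := by
  by_contra! ha
  have hb : 0 < |b| + 1 := by positivity
  have := h (-a / (2 * (|b| + 1))) (div_pos (by linarith) (by positivity))
  have h2 : -a / (2 * (|b| + 1)) * b ≤ -a / 2 := by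
    rw [div_mul_eq_mul_div, div_le_div_iff₀ (by positivity) (by positivity)]
    nlinarith [le_abs_self b]
  linarith

theorem eq_zero_of_forall_add_mul_nonneg {a b : ℝ} (h : ∀ t, 0 ≤ a + t * b) : b = 0 := by
  by_contra hb
  have := h (-(a + 1) / b)
  rw [div_mul_cancel₀ _ hb] at this
  linarith

/-- A convex set of matrices without elements of negative definite symmetric part is separated
from these by a nonzero positive semidefinite matrix. -/
theorem exists_posSemidef_trace_mul_nonneg {S : Set (Matrix ι ι ℝ)}
    (hS : Convex ℝ S) (hne : S.Nonempty)
    (hdisj : ∀ M ∈ S, ¬ ∀ x : ι → ℝ, x ≠ 0 → x ⬝ᵥ (M *ᵥ x) < 0) :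
    ∃ G : Matrix ι ι ℝ, G.PosSemidef ∧ G ≠ 0 ∧ ∀ M ∈ S, 0 ≤ (G * M).trace := by
  classical
  obtain ⟨f, u, hf, hu⟩ := geometric_hahn_banach_open convex_setOf_form_neg isOpen_setOf_form_neg
    hS (Set.disjoint_left.2 fun M h h' ↦ hdisj M h' h)
  -- `G` represents the separating functional through the trace pairing.
  let G : Matrix ι ι ℝ := Matrix.of fun i j ↦ f (Matrix.single j i 1)
  have hG : ∀ M, f M = (G * M).trace := by
    intro M
    conv_lhs => rw [Matrix.matrix_eq_sum_single M]
    simp only [map_sum, Matrix.trace, Matrix.diag_apply, Matrix.mul_apply, G, Matrix.of_apply]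
    rw [Finset.sum_comm]
    refine Finset.sum_congr rfl fun i _ ↦ Finset.sum_congr rfl fun j _ ↦ ?_
    rw [← mul_one (M j i), ← smul_eq_mul, ← Matrix.smul_single, map_smul, smul_eq_mul, smul_eq_mul]
    ring
  have hpos : ∀ x : ι → ℝ, x ≠ 0 → 0 < x ⬝ᵥ x := fun x hx ↦
    lt_of_le_of_ne (by simpa using dotProduct_self_star_nonneg x)
      (fun h' ↦ hx (dotProduct_self_eq_zero.1 h'.symm))
  -- The functional is bounded above on a cone, hence nonpositive there.
  have hneg : ∀ M : Matrix ι ι ℝ, (∀ x : ι → ℝ, x ≠ 0 → x ⬝ᵥ (M *ᵥ x) < 0) → f M ≤ 0 := by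
    intro M hM
    by_contra! h
    have := hf (((|u| + 1) / f M) • M) fun x hx ↦ by
      rw [Matrix.smul_mulVec, dotProduct_smul, smul_eq_mul]
      exact mul_neg_of_pos_of_neg (by positivity) (hM x hx)
    rw [map_smul, smul_eq_mul, div_mul_cancel₀ _ h.ne'] at this
    linarith [le_abs_self u]
  have hone : ∀ ε : ℝ, 0 < ε → ∀ x : ι → ℝ, x ≠ 0 → x ⬝ᵥ ((ε • (-1 : Matrix ι ι ℝ)) *ᵥ x) < 0 := by
    intro ε hε x hx
    rw [Matrix.smul_mulVec, Matrix.neg_mulVec, Matrix.one_mulVec, dotProduct_smul, dotProduct_neg,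
      smul_eq_mul]
    nlinarith [hpos x hx]
  have hu0 : 0 ≤ u := by
    refine nonneg_of_forall_pos_add_mul (b := f 1) fun ε hε ↦ ?_
    have := hf _ (hone ε hε)
    rw [map_smul, map_neg, smul_eq_mul] at this
    linarith
  refine ⟨G, ?_, ?_, fun M hM ↦ ?_⟩
  · refine Matrix.posSemidef_iff_dotProduct_mulVec.2 ⟨?_, fun x ↦ ?_⟩
    · ext i j
      rw [Matrix.conjTranspose_apply, star_trivial]
      simp only [G, Matrix.of_apply]
      rw [← sub_eq_zero, ← map_sub]
      refine eq_zero_of_forall_add_mul_nonneg (a := f 1) fun t ↦ ?_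
      -- A skew perturbation of `-1` of any size leaves its quadratic form unchanged, so `f`
      -- vanishes on skew matrices and `G` is symmetric.
      have := hneg ((-1 : Matrix ι ι ℝ) + (-t) • (Matrix.single i j 1 - Matrix.single j i 1))
        fun x hx ↦ by
          have e : x ⬝ᵥ ((Matrix.single i j (1 : ℝ) - Matrix.single j i 1) *ᵥ x) = 0 := by
            have h1 := Matrix.dotProduct_mulVec_comm_transpose (Matrix.single i j (1 : ℝ)) x x
            rw [Matrix.transpose_single] at h1
            rw [Matrix.sub_mulVec, dotProduct_sub, h1, sub_self]
          rw [Matrix.add_mulVec, dotProduct_add, Matrix.smul_mulVec, dotProduct_smul, e,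
            Matrix.neg_mulVec, Matrix.one_mulVec, dotProduct_neg, smul_zero, add_zero]
          linarith [hpos x hx]
      rw [map_add, map_neg, map_smul, smul_eq_mul] at this
      linarith
    · rw [star_trivial]
      refine nonneg_of_forall_pos_add_mul (b := f 1) fun ε hε ↦ ?_
      have := hneg (-Matrix.vecMulVec x x + ε • (-1 : Matrix ι ι ℝ)) fun y hy ↦ by
        have h1 := hone ε hε y hy
        rw [Matrix.add_mulVec, dotProduct_add, Matrix.neg_mulVec, dotProduct_neg,
          Matrix.vecMulVec_mulVec, op_smul_eq_smul, dotProduct_smul, smul_eq_mul,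
          dotProduct_comm x y]
        nlinarith [mul_self_nonneg (y ⬝ᵥ x)]
      rw [map_add, map_neg, map_smul, map_neg, smul_eq_mul, hG, Matrix.mul_vecMulVec,
        Matrix.trace_vecMulVec, dotProduct_comm] at this
      linarith
  · intro h0
    obtain ⟨M, hM⟩ := hne
    have h1 := hu M hM
    have h2 := hf _ (hone 1 one_pos)
    rw [hG, h0, Matrix.zero_mul, Matrix.trace_zero] at h1 h2
    linarith
  · rw [← hG]
    exact hu0.trans (hu M hM)

end Separation

/-! ### Generalized eigenvectors of a singular pair -/

section GeneralizedEigenvector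

variable {ι : Type*} [Fintype ι]

/-- `N` descends to the quotient by `ker H`, which is the range of `H`; the resulting map extends to
the whole space. -/
theorem Matrix.exists_eq_mul_of_ker_le [DecidableEq ι] {H N : Matrix ι ι ℝ}
    (h : ∀ x, H *ᵥ x = 0 → N *ᵥ x = 0) : ∃ S : Matrix ι ι ℝ, N = S * H := by
  let f : LinearMap.range H.mulVecLin →ₗ[ℝ] (ι → ℝ) :=
    (LinearMap.ker H.mulVecLin).liftQ N.mulVecLin (fun x hx ↦ by simpa using h x (by simpa using hx))
      ∘ₗ (H.mulVecLin.quotKerEquivRange.symm : _ →ₗ[ℝ] _)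
  obtain ⟨g, hg⟩ := f.exists_extend
  refine ⟨LinearMap.toMatrix' g, Matrix.toLin'.injective ?_⟩
  rw [Matrix.toLin'_mul, Matrix.toLin'_toMatrix']
  refine LinearMap.ext fun x ↦ ?_
  have h1 := LinearMap.congr_fun hg ⟨H.mulVecLin x, LinearMap.mem_range_self _ x⟩
  rw [LinearMap.comp_apply, LinearMap.comp_apply, LinearEquiv.coe_coe,
    LinearMap.quotKerEquivRange_symm_apply_image _ x (LinearMap.mem_range_self _ x)] at h1
  exact h1.symm

/-- The kernel conditions give `M = S * H = H * Rᵀ`, so `S` maps the complexified range of `H` into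
itself. This range is nonzero, and an eigenvector `H x` of `S` in it satisfies `M x = z H x`. The
conclusion is its real form with `x = a + ib`. -/
theorem Matrix.exists_generalized_eigenvector [DecidableEq ι] {H M : Matrix ι ι ℝ} (hH : Hᵀ = H)
    (hH0 : H ≠ 0) (h₁ : ∀ x, H *ᵥ x = 0 → M *ᵥ x = 0) (h₂ : ∀ x, H *ᵥ x = 0 → Mᵀ *ᵥ x = 0) :
    ∃ (z : ℂ) (a b : ι → ℝ), (H *ᵥ a ≠ 0 ∨ H *ᵥ b ≠ 0) ∧
      M *ᵥ a = z.re • (H *ᵥ a) - z.im • (H *ᵥ b) ∧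
      M *ᵥ b = z.im • (H *ᵥ a) + z.re • (H *ᵥ b) := by
  obtain ⟨S, hS⟩ := Matrix.exists_eq_mul_of_ker_le h₁
  obtain ⟨R, hR⟩ := Matrix.exists_eq_mul_of_ker_le h₂
  replace hR : M = H * Rᵀ := by
    rw [← Matrix.transpose_transpose M, hR, Matrix.transpose_mul, hH]
  let c : Matrix ι ι ℝ → Matrix ι ι ℂ := fun L ↦ L.map Complex.ofRealHom
  have hcmul : ∀ L L', c (L * L') = c L * c L' := fun L L' ↦ Matrix.map_mul
  have hre : ∀ (L : Matrix ι ι ℝ) (w : ι → ℂ) i,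
      ((c L *ᵥ w) i).re = (L *ᵥ fun j ↦ (w j).re) i := by
    intro L w i
    simp [c, Matrix.mulVec, dotProduct]
  have him : ∀ (L : Matrix ι ι ℝ) (w : ι → ℂ) i,
      ((c L *ᵥ w) i).im = (L *ᵥ fun j ↦ (w j).im) i := by
    intro L w i
    simp [c, Matrix.mulVec, dotProduct]
  let W := LinearMap.range (c H).mulVecLin
  have hW : ∀ y ∈ W, (c S).mulVecLin y ∈ W := by
    rintro _ ⟨x, rfl⟩
    refine ⟨c Rᵀ *ᵥ x, ?_⟩
    simp only [Matrix.mulVecLin_apply, Matrix.mulVec_mulVec, ← hcmul, ← hS, ← hR]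
  have hWne : W ≠ ⊥ := by
    intro h
    refine hH0 ?_
    ext i j
    have h1 : (c H).mulVecLin (Pi.single j 1) = 0 := by
      have : (c H).mulVecLin (Pi.single j 1) ∈ W := LinearMap.mem_range_self _ _
      rwa [h] at this
    have h2 := congrFun h1 i
    simpa [c] using h2
  have : Nontrivial W := Submodule.nontrivial_iff_ne_bot.2 hWne
  obtain ⟨z, hz⟩ := Module.End.exists_eigenvalue ((c S).mulVecLin.restrict hW)
  obtain ⟨⟨_, x, rfl⟩, hy⟩ := hz.exists_hasEigenvector
  have hy1 : c M *ᵥ x = z • (c H *ᵥ x) := by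
    have := congrArg Subtype.val hy.apply_eq_smul
    rw [hS, hcmul, ← Matrix.mulVec_mulVec]
    exact this
  have hy2 : c H *ᵥ x ≠ 0 := fun h ↦ hy.2 (Subtype.ext h)
  refine ⟨z, fun i ↦ (x i).re, fun i ↦ (x i).im, ?_, _root_.funext fun i ↦ ?_,
    _root_.funext fun i ↦ ?_⟩
  · by_contra! h
    refine hy2 (_root_.funext fun i ↦ Complex.ext ?_ ?_)
    · rw [hre, h.1]; rfl
    · rw [him, h.2]; rfl
  · rw [← hre, hy1]
    simp [hre, him]
  · rw [← him, hy1]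
    simp [hre, him]
    ring

end GeneralizedEigenvector

/-! ### The Lyapunov criterion for one pair -/

section SinglePair

variable {ι κ : Type*} [Fintype ι] [DecidableEq ι] [Fintype κ] {α : ℝ}

/-- Infeasibility gives a dual certificate `G`, from which a left null vector of `zE - A` with `z`
in the closed sector is extracted. -/
theorem Admissible.exists_form_neg (h0 : 0 < α) (h1 : α ≤ 1) {E A : Matrix ι ι ℝ}
    {E₁ : Matrix ι κ ℝ} (hEE₁ : E * E₁ = 0) (hr : E.rank + E₁.rank = Fintype.card ι)
    (h : Admissible α E A) :
    ∃ P ∈ fracPosDef α ι, ∃ Q : Matrix κ ι ℝ, ∀ x : ι → ℝ, x ≠ 0 →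
      x ⬝ᵥ ((A * (P * Eᵀ + E₁ * Q)) *ᵥ x) < 0 := by
  by_contra! hcon
  obtain ⟨-, himp, hstab⟩ := h
  let S : Set (Matrix ι ι ℝ) :=
    {M | ∃ P ∈ fracPosDef α ι, ∃ Q : Matrix κ ι ℝ, M = A * (P * Eᵀ + E₁ * Q)}
  obtain ⟨G, hG, hG0, htr⟩ : ∃ G : Matrix ι ι ℝ, G.PosSemidef ∧ G ≠ 0 ∧
      ∀ M ∈ S, 0 ≤ (G * M).trace := by
    refine exists_posSemidef_trace_mul_nonneg ?_
      ⟨_, _, rankOne_add_smul_one_mem_fracPosDef 0 0 one_pos, 0, rfl⟩ ?_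
    · rintro _ ⟨P, hP, Q, rfl⟩ _ ⟨P', hP', Q', rfl⟩ a b ha hb hab
      refine ⟨a • P + b • P', convex_fracPosDef hP hP' ha hb hab, a • Q + b • Q', ?_⟩
      simp only [Matrix.mul_add, Matrix.add_mul, Matrix.mul_smul, Matrix.smul_mul, smul_add]
      abel
    · rintro _ ⟨P, hP, Q, rfl⟩ hneg
      obtain ⟨x, hx, hx'⟩ := hcon P hP Q
      exact absurd (hneg x hx) (not_lt.2 hx')
  have htr' : ∀ P ∈ fracPosDef α ι, ∀ Q : Matrix κ ι ℝ,
      0 ≤ (Eᵀ * G * A * P).trace + (G * A * E₁ * Q).trace := by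
    intro P hP Q
    have := htr _ ⟨P, hP, Q, rfl⟩
    rw [Matrix.mul_add, Matrix.mul_add, Matrix.trace_add] at this
    convert this using 2
    · rw [Matrix.trace_mul_comm G, Matrix.mul_assoc A, Matrix.mul_assoc P, Matrix.trace_mul_comm A,
        Matrix.mul_assoc P, Matrix.trace_mul_comm P]
    · simp only [Matrix.mul_assoc]
  -- `Q` ranges over a linear space, so the trace can stay bounded below only if its coefficient
  -- vanishes.
  have hGAE : G * A * E₁ = 0 := by
    rw [← Matrix.trace_mul_conjTranspose_self_eq_zero_iff]
    obtain ⟨P, hP⟩ : (fracPosDef α ι).Nonempty :=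
      ⟨_, rankOne_add_smul_one_mem_fracPosDef 0 0 one_pos⟩
    refine eq_zero_of_forall_add_mul_nonneg (a := (Eᵀ * G * A * P).trace) fun t ↦ ?_
    have := htr' P hP (t • (G * A * E₁)ᴴ)
    rwa [Matrix.mul_smul (G * A * E₁), Matrix.trace_smul, smul_eq_mul] at this
  let N := Eᵀ * G * A
  let H := Eᵀ * G * E
  have hGt : Gᵀ = G := by
    simpa [Matrix.IsHermitian, Matrix.conjTranspose_eq_transpose_of_trivial] using hG.isHermitian
  have hHt : Hᵀ = H := by
    simp [H, Matrix.transpose_mul, hGt, Matrix.mul_assoc]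
  have hNt : Nᵀ = Aᵀ * G * E := by
    simp [N, Matrix.transpose_mul, hGt, Matrix.mul_assoc]
  have hHform : ∀ x, x ⬝ᵥ (H *ᵥ x) = (E *ᵥ x) ⬝ᵥ (G *ᵥ (E *ᵥ x)) := by
    intro x
    simp only [H, ← Matrix.mulVec_mulVec]
    rw [Matrix.dotProduct_mulVec_comm_transpose, Matrix.transpose_transpose, dotProduct_comm]
  have hHnonneg : ∀ x, 0 ≤ x ⬝ᵥ (H *ᵥ x) := fun x ↦ by
    rw [hHform]
    simpa using hG.dotProduct_mulVec_nonneg (E *ᵥ x)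
  have hHker : ∀ x, x ⬝ᵥ (H *ᵥ x) = 0 → G *ᵥ (E *ᵥ x) = 0 := fun x hx ↦ by
    rw [hHform] at hx
    exact (hG.dotProduct_mulVec_zero_iff _).1 (by simpa using hx)
  have hHpos : ∀ x, H *ᵥ x ≠ 0 → 0 < x ⬝ᵥ (H *ᵥ x) := fun x hx ↦
    lt_of_le_of_ne (hHnonneg x) fun h ↦ hx (by
      simp only [H, ← Matrix.mulVec_mulVec]
      rw [hHker x h.symm, Matrix.mulVec_zero])
  have hform : ∀ a b : ι → ℝ, 0 ≤
      Real.sin (α * Real.pi / 2) * (a ⬝ᵥ (N *ᵥ a) + b ⬝ᵥ (N *ᵥ b)) +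
        Real.cos (α * Real.pi / 2) * (a ⬝ᵥ (N *ᵥ b) - b ⬝ᵥ (N *ᵥ a)) := by
    intro a b
    refine nonneg_of_forall_pos_add_mul (b := Real.sin (α * Real.pi / 2) * N.trace) fun ε hε ↦ ?_
    have := htr' _ (rankOne_add_smul_one_mem_fracPosDef a b hε) 0
    simp only [Matrix.mul_zero, Matrix.trace_zero, add_zero, Matrix.mul_add, Matrix.mul_sub,
      Matrix.mul_smul, Matrix.mul_vecMulVec, Matrix.trace_add, Matrix.trace_sub,
      Matrix.trace_smul, Matrix.trace_vecMulVec, Matrix.mul_one, smul_eq_mul] at this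
    have c : ∀ x y : ι → ℝ, x ⬝ᵥ (N *ᵥ y) = (Eᵀ * G * A) *ᵥ y ⬝ᵥ x := fun x y ↦ dotProduct_comm _ _
    rw [c, c, c, c]
    linarith
  have hs := sin_order_pos h0 h1
  have hNtker : ∀ x, H *ᵥ x = 0 → Nᵀ *ᵥ x = 0 := by
    intro x hx
    rw [hNt, ← Matrix.mulVec_mulVec, ← Matrix.mulVec_mulVec, hHker x (by rw [hx, dotProduct_zero]),
      Matrix.mulVec_zero]
  have hNker : ∀ x, H *ᵥ x = 0 → N *ᵥ x = 0 := by
    intro x hx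
    refine dotProduct_self_eq_zero.1 ?_
    have e : ∀ y, x ⬝ᵥ (N *ᵥ y) = 0 := fun y ↦ by
      rw [Matrix.dotProduct_mulVec_comm_transpose, hNtker x hx, dotProduct_zero]
    have exx := e x
    set y := N *ᵥ x with hy
    have hmul : Real.sin (α * Real.pi / 2) * (y ⬝ᵥ y) = 0 := by
      -- Since `Nᵀ x = 0`, the form of `N` at `x + t y` has no constant term and its linear term is
      -- `t (y ⬝ᵥ y)`. Nonnegativity for small negative `t` forces `y = 0`.
      have key : ∀ t : ℝ, 0 ≤ t * (y ⬝ᵥ y) + t * t * (y ⬝ᵥ (N *ᵥ y)) := by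
        intro t
        have := hform (x + t • y) 0
        simp only [Matrix.mulVec_add, Matrix.mulVec_smul, dotProduct_add, add_dotProduct,
          smul_dotProduct, dotProduct_smul, smul_eq_mul, e, ← hy, Matrix.mulVec_zero,
          dotProduct_zero, zero_dotProduct, mul_zero, add_zero, zero_add, sub_zero] at this
        have := (mul_nonneg_iff_of_pos_left hs).1 this
        linarith [exx]
      have h3 : 0 ≤ -(y ⬝ᵥ y) := by
        refine nonneg_of_forall_pos_add_mul (b := y ⬝ᵥ (N *ᵥ y)) fun ε hε ↦ ?_
        have := key (-ε)
        nlinarith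
      have h4 : 0 ≤ y ⬝ᵥ y := by simpa using dotProduct_self_star_nonneg y
      rw [le_antisymm (by linarith) h4, mul_zero]
    exact (mul_eq_zero.1 hmul).resolve_left hs.ne'
  -- If `H = 0` then `GE = 0`; with `GAE₁ = 0` and `ker E = range E₁`, impulse-freeness kills every
  -- vector `G y`.
  have hH0 : H ≠ 0 := by
    intro hH0
    have hGE : ∀ x, G *ᵥ (E *ᵥ x) = 0 := fun x ↦ hHker x (by rw [hH0]; simp)
    refine hG0 (Matrix.toLin'.injective (LinearMap.ext fun y ↦ ?_))
    rw [map_zero, LinearMap.zero_apply, Matrix.toLin'_apply]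
    refine pairImpulseFree_iff.1 himp _ ?_ ?_
    · refine dotProduct_eq_zero _ fun x ↦ ?_
      rw [← Matrix.dotProduct_mulVec, dotProduct_comm, Matrix.dotProduct_mulVec_comm_transpose,
        hGt, hGE, dotProduct_zero]
    · intro x hx
      obtain ⟨w, rfl⟩ := Matrix.exists_mulVec_eq_of_mulVec_eq_zero hEE₁ hr hx
      rw [dotProduct_comm, Matrix.dotProduct_mulVec_comm_transpose, hGt, Matrix.mulVec_mulVec,
        Matrix.mulVec_mulVec, hGAE, Matrix.zero_mulVec, dotProduct_zero]
  obtain ⟨z, a, b, hab, hMa, hMb⟩ := Matrix.exists_generalized_eigenvector (M := Nᵀ) hHt hH0 hNtker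
    (by simpa using hNker)
  have hHE : ∀ x, H *ᵥ x = Eᵀ *ᵥ (G *ᵥ (E *ᵥ x)) := fun x ↦ by
    simp only [H, Matrix.mulVec_mulVec, Matrix.mul_assoc]
  have hNE : ∀ x, Nᵀ *ᵥ x = Aᵀ *ᵥ (G *ᵥ (E *ᵥ x)) := fun x ↦ by
    simp only [hNt, Matrix.mulVec_mulVec, Matrix.mul_assoc]
  have hdet := (det_pencil_eq_zero_iff E A z).2 ⟨G *ᵥ (E *ᵥ a), G *ᵥ (E *ᵥ b), ?_, ?_, ?_⟩
  rotate_left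
  · refine hab.imp (fun h h' ↦ h ?_) (fun h h' ↦ h ?_) <;> rw [hHE, h', Matrix.mulVec_zero]
  · rw [← hNE, ← hHE, ← hHE, hMa]
  · rw [← hNE, ← hHE, ← hHE, hMb]
  refine (hstab z hdet).not_ge ((abs_arg_le_iff h0 h1 z).2 ?_)
  have hh : 0 < a ⬝ᵥ (H *ᵥ a) + b ⬝ᵥ (H *ᵥ b) := by
    rcases hab with h | h
    · exact add_pos_of_pos_of_nonneg (hHpos a h) (hHnonneg b)
    · exact add_pos_of_nonneg_of_pos (hHnonneg a) (hHpos b h)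
  have hsym : b ⬝ᵥ (H *ᵥ a) = a ⬝ᵥ (H *ᵥ b) := by
    rw [Matrix.dotProduct_mulVec_comm_transpose, hHt]
  have n1 : a ⬝ᵥ (N *ᵥ a) = z.re * (a ⬝ᵥ (H *ᵥ a)) - z.im * (a ⬝ᵥ (H *ᵥ b)) := by
    rw [Matrix.dotProduct_mulVec_comm_transpose, hMa]; simp
  have n2 : b ⬝ᵥ (N *ᵥ b) = z.im * (a ⬝ᵥ (H *ᵥ b)) + z.re * (b ⬝ᵥ (H *ᵥ b)) := by
    rw [Matrix.dotProduct_mulVec_comm_transpose, hMb]; simp [hsym]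
  have n3 : a ⬝ᵥ (N *ᵥ b) = z.re * (a ⬝ᵥ (H *ᵥ b)) - z.im * (b ⬝ᵥ (H *ᵥ b)) := by
    rw [Matrix.dotProduct_mulVec_comm_transpose, hMa]; simp [hsym]
  have n4 : b ⬝ᵥ (N *ᵥ a) = z.im * (a ⬝ᵥ (H *ᵥ a)) + z.re * (a ⬝ᵥ (H *ᵥ b)) := by
    rw [Matrix.dotProduct_mulVec_comm_transpose, hMb]; simp
  -- The two orders of `a` and `b` give the two half-planes whose intersection is the sector.
  have q1 := hform a b
  have q2 := hform b a
  rw [n1, n2, n3, n4] at q1 q2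
  set s := Real.sin (α * Real.pi / 2)
  set c := Real.cos (α * Real.pi / 2)
  have r1 : 0 ≤ (s * z.re - c * z.im) * (a ⬝ᵥ (H *ᵥ a) + b ⬝ᵥ (H *ᵥ b)) := by linarith
  have r2 : 0 ≤ (s * z.re + c * z.im) * (a ⬝ᵥ (H *ᵥ a) + b ⬝ᵥ (H *ᵥ b)) := by linarith
  have t1 := nonneg_of_mul_nonneg_left r1 hh
  have t2 := nonneg_of_mul_nonneg_left r2 hh
  rcases abs_cases z.im with ⟨h, -⟩ | ⟨h, -⟩ <;> rw [h] <;> linarith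

/-- If `gᵀE = 0`, then `T g = E₁ Q g` lies in `ker E`, so a violation of impulse-freeness makes the
form vanish at `g`. If `g + ik` is a left null vector of `zE - A`, the forms at `g` and `k` add up
to the expression in `sector_form_nonneg` at `Eᵀg`, `Eᵀk`, because `E * E₁ = 0` removes `Q`. -/
theorem admissible_of_form_neg (h0 : 0 < α) (h1 : α ≤ 1) {E A P : Matrix ι ι ℝ}
    {E₁ : Matrix ι κ ℝ} {Q : Matrix κ ι ℝ} (hEE₁ : E * E₁ = 0) (hP : P ∈ fracPosDef α ι)
    (h : ∀ x : ι → ℝ, x ≠ 0 → x ⬝ᵥ ((A * (P * Eᵀ + E₁ * Q)) *ᵥ x) < 0) :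
    Admissible α E A := by
  have himp : PairImpulseFree E A := by
    refine pairImpulseFree_iff.2 fun g hgE hgA ↦ ?_
    by_contra hg
    refine (h g hg).ne ?_
    have e1 : (P * Eᵀ + E₁ * Q) *ᵥ g = E₁ *ᵥ (Q *ᵥ g) := by
      rw [Matrix.add_mulVec, ← Matrix.mulVec_mulVec, Matrix.mulVec_transpose, hgE,
        Matrix.mulVec_zero, zero_add, Matrix.mulVec_mulVec]
    rw [← Matrix.mulVec_mulVec, e1]
    exact hgA _ (by rw [Matrix.mulVec_mulVec, hEE₁, Matrix.zero_mulVec])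
  refine ⟨himp.pairRegular, himp, fun z hz ↦ ?_⟩
  by_contra! harg
  rw [abs_arg_le_iff h0 h1] at harg
  obtain ⟨g, k, hgk, hg, hk⟩ := (det_pencil_eq_zero_iff E A z).1 hz
  have hneg : g ⬝ᵥ ((A * (P * Eᵀ + E₁ * Q)) *ᵥ g) + k ⬝ᵥ ((A * (P * Eᵀ + E₁ * Q)) *ᵥ k) < 0 := by
    have h' : ∀ x : ι → ℝ, x ⬝ᵥ ((A * (P * Eᵀ + E₁ * Q)) *ᵥ x) ≤ 0 := fun x ↦ by
      rcases eq_or_ne x 0 with rfl | hx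
      · simp
      · exact (h x hx).le
    rcases hgk with hne | hne
    · linarith [h g hne, h' k]
    · linarith [h k hne, h' g]
  have hAT : ∀ x y w : ι → ℝ, Aᵀ *ᵥ x = w → x ⬝ᵥ ((A * (P * Eᵀ + E₁ * Q)) *ᵥ y) =
      w ⬝ᵥ ((P * Eᵀ + E₁ * Q) *ᵥ y) := by
    rintro x y _ rfl
    rw [← Matrix.mulVec_mulVec, Matrix.dotProduct_mulVec_comm_transpose, dotProduct_comm]
  have hET : ∀ x y : ι → ℝ, (Eᵀ *ᵥ x) ⬝ᵥ ((P * Eᵀ + E₁ * Q) *ᵥ y) =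
      (Eᵀ *ᵥ x) ⬝ᵥ (P *ᵥ (Eᵀ *ᵥ y)) := by
    intro x y
    rw [Matrix.add_mulVec, dotProduct_add, ← Matrix.mulVec_mulVec, add_eq_left, dotProduct_comm,
      ← Matrix.dotProduct_mulVec_comm_transpose, Matrix.mulVec_mulVec, ← Matrix.mul_assoc, hEE₁,
      Matrix.zero_mul, Matrix.zero_mulVec, dotProduct_zero]
  rw [hAT g g _ hg, hAT k k _ hk] at hneg
  simp only [sub_dotProduct, add_dotProduct, smul_dotProduct, smul_eq_mul, hET] at hneg
  have := sector_form_nonneg h0 h1 hP harg (Eᵀ *ᵥ g) (Eᵀ *ᵥ k)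
  nlinarith

end SinglePair

/-! ### Splitting the closed loop -/

/-- The pencil determinant is the product of those of the diagonal blocks. Each factor has degree at
most `rank E`, so a total of `2 rank E` forces equality in both. -/
theorem admissible_fromBlocks_iff {ι : Type*} [Fintype ι] [DecidableEq ι] {α : ℝ}
    {E A₁ F A₂ : Matrix ι ι ℝ} :
    Admissible α (Matrix.fromBlocks E 0 0 E) (Matrix.fromBlocks A₁ F 0 A₂) ↔
      Admissible α E A₁ ∧ Admissible α E A₂ := by
  have hdet : ∀ z : ℂ, (z • (Matrix.fromBlocks E 0 0 E).map Complex.ofReal -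
      (Matrix.fromBlocks A₁ F 0 A₂).map Complex.ofReal).det =
        (z • E.map Complex.ofReal - A₁.map Complex.ofReal).det *
          (z • E.map Complex.ofReal - A₂.map Complex.ofReal).det := by
    intro z
    rw [← Matrix.det_fromBlocks_zero₂₁ _ (-F.map Complex.ofReal)]
    congr 1
    ext (i | i) (j | j) <;> simp
  have hpoly : pencilDet (Matrix.fromBlocks E 0 0 E) (Matrix.fromBlocks A₁ F 0 A₂) =
      pencilDet E A₁ * pencilDet E A₂ := by
    rw [pencilDet, pencilDet, pencilDet, ← Matrix.det_fromBlocks_zero₂₁ _ (-F.map C)]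
    congr 1
    ext1 (i | i) (j | j) <;>
      simp only [Matrix.sub_apply, Matrix.smul_apply, Matrix.map_apply, Matrix.fromBlocks_apply₁₁,
        Matrix.fromBlocks_apply₁₂, Matrix.fromBlocks_apply₂₁, Matrix.fromBlocks_apply₂₂,
        Matrix.zero_apply, Matrix.neg_apply, C_0, smul_zero, zero_sub, sub_zero]
  have himp : PairImpulseFree (Matrix.fromBlocks E 0 0 E) (Matrix.fromBlocks A₁ F 0 A₂) ↔
      PairImpulseFree E A₁ ∧ PairImpulseFree E A₂ := by
    simp only [PairImpulseFree, hpoly, Matrix.rank_fromBlocks_zero_zero, degree_mul]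
    constructor
    · intro h
      have h1 : pencilDet E A₁ ≠ 0 := by
        intro h0
        rw [h0, degree_zero, WithBot.bot_add] at h
        exact WithBot.bot_ne_coe h
      have h2 : pencilDet E A₂ ≠ 0 := by
        intro h0
        rw [h0, degree_zero, WithBot.add_bot] at h
        exact WithBot.bot_ne_coe h
      have l1 := natDegree_pencilDet_le_rank E A₁
      have l2 := natDegree_pencilDet_le_rank E A₂
      rw [degree_eq_natDegree h1, degree_eq_natDegree h2] at h ⊢
      norm_cast at h ⊢
      omega
    · rintro ⟨h1, h2⟩
      rw [h1, h2]
      norm_cast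
  constructor
  · rintro ⟨-, hi, hs⟩
    obtain ⟨hi1, hi2⟩ := himp.1 hi
    refine ⟨⟨hi1.pairRegular, hi1, fun z hz ↦ hs z ?_⟩, ⟨hi2.pairRegular, hi2, fun z hz ↦ hs z ?_⟩⟩
    · rw [hdet, hz, zero_mul]
    · rw [hdet, hz, mul_zero]
  · rintro ⟨⟨-, hi1, hs1⟩, ⟨-, hi2, hs2⟩⟩
    have hi := himp.2 ⟨hi1, hi2⟩
    refine ⟨hi.pairRegular, hi, fun z hz ↦ ?_⟩
    rw [hdet, mul_eq_zero] at hz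
    exact hz.elim (hs1 z) (hs2 z)

/-! ### Recovering the gains -/

section Gains

variable {ι κ μ : Type*} [Fintype ι] [DecidableEq ι] [Fintype κ] [Fintype μ] {α : ℝ}

theorem isUnit_right_of_form_neg {M T : Matrix ι ι ℝ}
    (h : ∀ x : ι → ℝ, x ≠ 0 → x ⬝ᵥ ((M * T) *ᵥ x) < 0) : IsUnit T := by
  rw [Matrix.isUnit_iff_isUnit_det, isUnit_iff_ne_zero]
  intro h0
  obtain ⟨x, hx, hTx⟩ := Matrix.exists_mulVec_eq_zero_iff.2 h0
  refine (h x hx).ne ?_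
  rw [← Matrix.mulVec_mulVec, hTx, Matrix.mulVec_zero, dotProduct_zero]

/-- Pairing `T x = 0` with `Eᵀx` removes the `E₁` term and gives `Eᵀx = 0` by positivity of `P`.
Then `E₂ x = 0` as `E₁` is injective, while `x` lies in the range of `E₂ᵀ`; hence `x ⬝ᵥ x = 0`. -/
theorem isUnit_fracPosDef_mul_add (h0 : 0 < α) (h1 : α ≤ 1) {E P : Matrix ι ι ℝ}
    {E₁ : Matrix ι κ ℝ} {E₂ : Matrix κ ι ℝ} (hP : P ∈ fracPosDef α ι)
    (hEE₁ : E * E₁ = 0) (hE₂E : E₂ * E = 0) (hE₁ : E₁.rank = Fintype.card κ)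
    (hr : E.rank + E₂.rank = Fintype.card ι) : IsUnit (P * Eᵀ + E₁ * E₂) := by
  rw [Matrix.isUnit_iff_isUnit_det, isUnit_iff_ne_zero]
  intro hdet
  obtain ⟨x, hx, hTx⟩ := Matrix.exists_mulVec_eq_zero_iff.2 hdet
  rw [Matrix.add_mulVec, ← Matrix.mulVec_mulVec, ← Matrix.mulVec_mulVec] at hTx
  have hEx : Eᵀ *ᵥ x = 0 := by
    by_contra hne
    have h2 := fracPosDef_form_pos h0 h1 hP hne
    have h3 := congrArg (fun y ↦ (Eᵀ *ᵥ x) ⬝ᵥ y) hTx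
    simp only [dotProduct_add, dotProduct_zero] at h3
    have h4 : (Eᵀ *ᵥ x) ⬝ᵥ (E₁ *ᵥ (E₂ *ᵥ x)) = 0 := by
      rw [dotProduct_comm, ← Matrix.dotProduct_mulVec_comm_transpose, Matrix.mulVec_mulVec, hEE₁,
        Matrix.zero_mulVec, dotProduct_zero]
    linarith
  rw [hEx, Matrix.mulVec_zero, zero_add] at hTx
  have hE₂x : E₂ *ᵥ x = 0 := by
    have hker : LinearMap.ker E₁.mulVecLin = ⊥ := by
      have := LinearMap.finrank_range_add_finrank_ker E₁.mulVecLin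
      rw [Module.finrank_fintype_fun_eq_card, ← hE₁, Matrix.rank] at this
      exact Submodule.finrank_eq_zero.1 (by omega)
    exact LinearMap.ker_eq_bot'.1 hker _ hTx
  obtain ⟨y, rfl⟩ := Matrix.exists_mulVec_eq_of_mulVec_eq_zero (E := Eᵀ) (F := E₂ᵀ)
    (by rw [← Matrix.transpose_mul, hE₂E, Matrix.transpose_zero])
    (by rw [Matrix.rank_transpose, Matrix.rank_transpose, hr]) hEx
  refine hx (dotProduct_self_eq_zero.1 ?_)
  rw [Matrix.dotProduct_mulVec_comm_transpose, Matrix.transpose_transpose, hE₂x, dotProduct_zero]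

/-- Feasibility of the inequality persists under small perturbations, while invertibility fails for
finitely many points of a line only. -/
theorem exists_form_neg_and_isUnit {M₀ M₁ T₀ T₁ : Matrix ι ι ℝ}
    (hM : ∀ x : ι → ℝ, x ≠ 0 → x ⬝ᵥ (M₀ *ᵥ x) < 0) (hT : IsUnit (T₀ + T₁)) :
    ∃ t : ℝ, (∀ x : ι → ℝ, x ≠ 0 → x ⬝ᵥ ((M₀ + t • M₁) *ᵥ x) < 0) ∧ IsUnit (T₀ + t • T₁) := by
  let D : ℝ[X] := ((X : ℝ[X]) • T₁.map C + T₀.map C).det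
  have hD : ∀ t, D.eval t = (T₀ + t • T₁).det := by
    intro t
    rw [← Polynomial.coe_evalRingHom, RingHom.map_det]
    congr 1
    ext i j
    simp only [RingHom.mapMatrix_apply, Matrix.map_apply, Matrix.add_apply, Matrix.smul_apply,
      smul_eq_mul, coe_evalRingHom, eval_add, eval_mul, eval_X, eval_C, add_comm]
  have hD0 : D ≠ 0 := by
    intro h
    have h2 := hD 1
    rw [h, eval_zero, one_smul] at h2
    exact ((Matrix.isUnit_iff_isUnit_det _).1 hT).ne_zero h2.symm
  have hcont : Continuous fun t : ℝ ↦ M₀ + t • M₁ := by fun_prop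
  have hmem : (fun t : ℝ ↦ M₀ + t • M₁) ⁻¹' {M | ∀ x : ι → ℝ, x ≠ 0 → x ⬝ᵥ (M *ᵥ x) < 0} ∈
      nhds (0 : ℝ) :=
    (isOpen_setOf_form_neg.preimage hcont).mem_nhds (by simpa using hM)
  obtain ⟨t, ht, ht'⟩ := (infinite_of_mem_nhds 0 hmem).exists_notMem_finset D.roots.toFinset
  refine ⟨t, ht, ?_⟩
  rw [Matrix.isUnit_iff_isUnit_det, isUnit_iff_ne_zero, ← hD]
  simpa [hD0] using ht'

/-- The substitution `R = K * T` linearizes the criterion for `A + B * K`; `T` is invertible because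
a null vector of it would annihilate the form. -/
theorem admissible_add_mul_iff (h0 : 0 < α) (h1 : α ≤ 1) {E A : Matrix ι ι ℝ} {B : Matrix ι μ ℝ}
    {E₁ : Matrix ι κ ℝ} (hEE₁ : E * E₁ = 0) (hr : E.rank + E₁.rank = Fintype.card ι)
    (K : Matrix μ ι ℝ) :
    Admissible α E (A + B * K) ↔
      ∃ P ∈ fracPosDef α ι, ∃ (Q : Matrix κ ι ℝ) (R : Matrix μ ι ℝ),
        NegDef (symPart (A * P * Eᵀ + A * E₁ * Q + B * R)) ∧
        IsUnit (P * Eᵀ + E₁ * Q) ∧ K = R * (P * Eᵀ + E₁ * Q)⁻¹ := by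
  have hexp : ∀ (P : Matrix ι ι ℝ) (Q : Matrix κ ι ℝ) (K : Matrix μ ι ℝ),
      (A + B * K) * (P * Eᵀ + E₁ * Q) =
        A * P * Eᵀ + A * E₁ * Q + B * (K * (P * Eᵀ + E₁ * Q)) := fun P Q K ↦ by
    rw [Matrix.add_mul, Matrix.mul_add A]
    simp only [Matrix.mul_assoc]
  constructor
  · intro h
    obtain ⟨P, hP, Q, hneg⟩ := h.exists_form_neg h0 h1 hEE₁ hr
    have hT := isUnit_right_of_form_neg hneg
    refine ⟨P, hP, Q, K * (P * Eᵀ + E₁ * Q), ?_, hT, ?_⟩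
    · rw [negDef_symPart_iff, ← hexp]
      exact hneg
    · rw [Matrix.mul_nonsing_inv_cancel_right _ _ ((Matrix.isUnit_iff_isUnit_det _).1 hT)]
  · rintro ⟨P, hP, Q, R, hneg, hT, rfl⟩
    refine admissible_of_form_neg h0 h1 (Q := Q) hEE₁ hP ?_
    rw [hexp, Matrix.nonsing_inv_mul_cancel_right _ _ ((Matrix.isUnit_iff_isUnit_det _).1 hT)]
    exact negDef_symPart_iff.1 hneg

theorem exists_admissible_add_mul_iff (h0 : 0 < α) (h1 : α ≤ 1) {E A : Matrix ι ι ℝ}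
    {B : Matrix ι μ ℝ} {E₁ : Matrix ι κ ℝ} {E₂ : Matrix κ ι ℝ} (hEE₁ : E * E₁ = 0)
    (hE₂E : E₂ * E = 0) (hE₁ : E₁.rank = Fintype.card κ) (hE₂ : E₂.rank = Fintype.card κ)
    (hr : E.rank + Fintype.card κ = Fintype.card ι) :
    (∃ K : Matrix μ ι ℝ, Admissible α E (A + B * K)) ↔
      ∃ P ∈ fracPosDef α ι, ∃ (Q : Matrix κ ι ℝ) (R : Matrix μ ι ℝ),
        NegDef (symPart (A * P * Eᵀ + A * E₁ * Q + B * R)) := by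
  constructor
  · rintro ⟨K, hK⟩
    obtain ⟨P, hP, Q, R, hneg, -⟩ :=
      (admissible_add_mul_iff h0 h1 hEE₁ (by rw [hE₁, hr]) K).1 hK
    exact ⟨P, hP, Q, R, hneg⟩
  · rintro ⟨P, hP, Q, R, hneg⟩
    -- `Q` moves along the line `Q + t (E₂ - Q)`. At `t = 1` it is `E₂`, where `T` is invertible, so
    -- `T` is invertible for all but finitely many `t`.
    obtain ⟨t, ht, hT⟩ := exists_form_neg_and_isUnit (M₁ := A * E₁ * (E₂ - Q))
      (T₀ := P * Eᵀ + E₁ * Q) (T₁ := E₁ * (E₂ - Q)) (negDef_symPart_iff.1 hneg) (by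
        rw [Matrix.mul_sub, add_add_sub_cancel]
        exact isUnit_fracPosDef_mul_add h0 h1 hP hEE₁ hE₂E hE₁ (by rw [hE₂, hr]))
    have e1 : A * P * Eᵀ + A * E₁ * Q + B * R + t • (A * E₁ * (E₂ - Q)) =
        A * P * Eᵀ + A * E₁ * (Q + t • (E₂ - Q)) + B * R := by
      rw [Matrix.mul_add (A * E₁), Matrix.mul_smul (A * E₁)]
      abel
    have e2 : P * Eᵀ + E₁ * Q + t • (E₁ * (E₂ - Q)) =
        P * Eᵀ + E₁ * (Q + t • (E₂ - Q)) := by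
      rw [Matrix.mul_add E₁, Matrix.mul_smul E₁]
      abel
    rw [e1] at ht
    rw [e2] at hT
    exact ⟨_, (admissible_add_mul_iff h0 h1 hEE₁ (by rw [hE₁, hr]) _).2
      ⟨P, hP, _, R, negDef_symPart_iff.2 ht, hT, rfl⟩⟩

theorem symPart_transpose {ι : Type*} (M : Matrix ι ι ℝ) : symPart Mᵀ = symPart M := by
  rw [symPart, symPart, Matrix.transpose_transpose, add_comm]

theorem symPart_observer_eq {ι κ μ : Type*} [Fintype ι] [Fintype κ]
    [Fintype μ] (E A P : Matrix ι ι ℝ) (C : Matrix μ ι ℝ) (E₂ : Matrix κ ι ℝ) (Q : Matrix ι κ ℝ) (R : Matrix ι μ ℝ) :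
    symPart (Aᵀ * Pᵀ * Eᵀᵀ + Aᵀ * E₂ᵀ * Qᵀ + Cᵀ * Rᵀ) = symPart (Eᵀ * P * A + Q * E₂ * A + R * C) := by
  rw [← symPart_transpose (Eᵀ * P * A + Q * E₂ * A + R * C)]
  simp only [Matrix.transpose_add, Matrix.transpose_mul, Matrix.mul_assoc]

/-- State feedback for `{Eᵀ, Aᵀ}` with input matrix `Cᵀ` and gain `Lᵀ`, where `E₂ᵀ` plays the role
of `E₁`. -/
theorem admissible_add_mul_right_iff (h0 : 0 < α) (h1 : α ≤ 1) {E A : Matrix ι ι ℝ}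
    {C : Matrix μ ι ℝ} {E₂ : Matrix κ ι ℝ} (hE₂E : E₂ * E = 0)
    (hr : E.rank + E₂.rank = Fintype.card ι) (L : Matrix ι μ ℝ) :
    Admissible α E (A + L * C) ↔
      ∃ P ∈ fracPosDef α ι, ∃ (Q : Matrix ι κ ℝ) (R : Matrix ι μ ℝ),
        NegDef (symPart (Eᵀ * P * A + Q * E₂ * A + R * C)) ∧
        IsUnit (Eᵀ * P + Q * E₂) ∧ L = (Eᵀ * P + Q * E₂)⁻¹ * R := by
  have hT : ∀ (P : Matrix ι ι ℝ) (Q : Matrix ι κ ℝ),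
      Pᵀ * Eᵀᵀ + E₂ᵀ * Qᵀ = (Eᵀ * P + Q * E₂)ᵀ := fun P Q ↦ by
    rw [Matrix.transpose_add, Matrix.transpose_mul, Matrix.transpose_mul]
  have hiff : ∀ (P : Matrix ι ι ℝ) (Q : Matrix ι κ ℝ) (R : Matrix ι μ ℝ),
      (NegDef (symPart (Aᵀ * Pᵀ * Eᵀᵀ + Aᵀ * E₂ᵀ * Qᵀ + Cᵀ * Rᵀ)) ∧
        IsUnit (Pᵀ * Eᵀᵀ + E₂ᵀ * Qᵀ) ∧ Lᵀ = Rᵀ * (Pᵀ * Eᵀᵀ + E₂ᵀ * Qᵀ)⁻¹) ↔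
      (NegDef (symPart (Eᵀ * P * A + Q * E₂ * A + R * C)) ∧
        IsUnit (Eᵀ * P + Q * E₂) ∧ L = (Eᵀ * P + Q * E₂)⁻¹ * R) := fun P Q R ↦ by
    rw [symPart_observer_eq, hT, Matrix.isUnit_transpose, ← Matrix.transpose_nonsing_inv,
      ← Matrix.transpose_mul, Matrix.transpose_inj]
  rw [← admissible_transpose_iff, Matrix.transpose_add, Matrix.transpose_mul,
    admissible_add_mul_iff h0 h1 (E₁ := E₂ᵀ)
      (by rw [← Matrix.transpose_mul, hE₂E, Matrix.transpose_zero])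
      (by rw [Matrix.rank_transpose, Matrix.rank_transpose, hr])]
  constructor
  · rintro ⟨P, hP, Q, R, h⟩
    exact ⟨Pᵀ, fracPosDef_transpose hP, Qᵀ, Rᵀ, (hiff _ _ _).1 (by simpa using h)⟩
  · rintro ⟨P, hP, Q, R, h⟩
    exact ⟨Pᵀ, fracPosDef_transpose hP, Qᵀ, Rᵀ, (hiff _ _ _).2 h⟩

theorem exists_admissible_add_mul_right_iff (h0 : 0 < α) (h1 : α ≤ 1) {E A : Matrix ι ι ℝ}
    {C : Matrix μ ι ℝ} {E₁ : Matrix ι κ ℝ} {E₂ : Matrix κ ι ℝ} (hEE₁ : E * E₁ = 0)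
    (hE₂E : E₂ * E = 0) (hE₁ : E₁.rank = Fintype.card κ) (hE₂ : E₂.rank = Fintype.card κ)
    (hr : E.rank + Fintype.card κ = Fintype.card ι) :
    (∃ L : Matrix ι μ ℝ, Admissible α E (A + L * C)) ↔
      ∃ P ∈ fracPosDef α ι, ∃ (Q : Matrix ι κ ℝ) (R : Matrix ι μ ℝ),
        NegDef (symPart (Eᵀ * P * A + Q * E₂ * A + R * C)) := by
  have key := exists_admissible_add_mul_iff h0 h1 (E := Eᵀ) (A := Aᵀ) (B := Cᵀ) (E₁ := E₂ᵀ)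
    (E₂ := E₁ᵀ) (by rw [← Matrix.transpose_mul, hE₂E, Matrix.transpose_zero])
    (by rw [← Matrix.transpose_mul, hEE₁, Matrix.transpose_zero])
    (by rw [Matrix.rank_transpose, hE₂]) (by rw [Matrix.rank_transpose, hE₁])
    (by rw [Matrix.rank_transpose, hr])
  have hadm : ∀ L : Matrix ι μ ℝ,
      Admissible α Eᵀ (Aᵀ + Cᵀ * Lᵀ) ↔ Admissible α E (A + L * C) := fun L ↦ by
    rw [← Matrix.transpose_mul, ← Matrix.transpose_add, admissible_transpose_iff]
  constructor
  · rintro ⟨L, hL⟩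
    obtain ⟨P, hP, Q, R, h⟩ := key.1 ⟨Lᵀ, (hadm L).2 hL⟩
    refine ⟨Pᵀ, fracPosDef_transpose hP, Qᵀ, Rᵀ, ?_⟩
    rw [← symPart_observer_eq]
    simpa using h
  · rintro ⟨P, hP, Q, R, h⟩
    obtain ⟨L, hL⟩ := key.2 ⟨Pᵀ, fracPosDef_transpose hP, Qᵀ, Rᵀ, by rwa [symPart_observer_eq]⟩
    exact ⟨Lᵀ, (hadm Lᵀ).1 (by simpa using hL)⟩

end Gains

end ObserverBasedControl

/-! ### The observer-based closed loop -/

theorem theorem2 (n m p r : ℕ) (α : ℝ) (hα0 : 0 < α) (hα1 : α ≤ 1)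
    (E A : Matrix (Fin n) (Fin n) ℝ) (B : Matrix (Fin n) (Fin m) ℝ)
    (C : Matrix (Fin p) (Fin n) ℝ)
    (hE : E.rank = r) (hrn : r < n)
    (E₁ : Matrix (Fin n) (Fin (n - r)) ℝ) (E₂ : Matrix (Fin (n - r)) (Fin n) ℝ)
    (hE₁ : E₁.rank = n - r) (hE₂ : E₂.rank = n - r)
    (hEE₁ : E * E₁ = 0) (hE₂E : E₂ * E = 0) :
    -- admissibility can be achieved if and only if the two inequalities are feasible
    ((∃ (K : Matrix (Fin m) (Fin n) ℝ) (L : Matrix (Fin n) (Fin p) ℝ),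
        Admissible α (augE E) (augA A B C K L)) ↔
      ∃ P₁ ∈ fracPosDef α (Fin n), ∃ P₂ ∈ fracPosDef α (Fin n),
      ∃ (Q₁ : Matrix (Fin (n - r)) (Fin n) ℝ) (Q₂ : Matrix (Fin n) (Fin (n - r)) ℝ)
        (R₁ : Matrix (Fin m) (Fin n) ℝ) (R₂ : Matrix (Fin n) (Fin p) ℝ),
        NegDef (symPart (A * P₁ * E.transpose + A * E₁ * Q₁ + B * R₁)) ∧
        NegDef (symPart (E.transpose * P₂ * A + Q₂ * E₂ * A + R₂ * C))) ∧
    -- the gains that achieve it are exactly those given by the formulas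
    (∀ (K : Matrix (Fin m) (Fin n) ℝ) (L : Matrix (Fin n) (Fin p) ℝ),
      Admissible α (augE E) (augA A B C K L) ↔
      ∃ P₁ ∈ fracPosDef α (Fin n), ∃ P₂ ∈ fracPosDef α (Fin n),
      ∃ (Q₁ : Matrix (Fin (n - r)) (Fin n) ℝ) (Q₂ : Matrix (Fin n) (Fin (n - r)) ℝ)
        (R₁ : Matrix (Fin m) (Fin n) ℝ) (R₂ : Matrix (Fin n) (Fin p) ℝ),
        NegDef (symPart (A * P₁ * E.transpose + A * E₁ * Q₁ + B * R₁)) ∧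
        NegDef (symPart (E.transpose * P₂ * A + Q₂ * E₂ * A + R₂ * C)) ∧
        IsUnit (P₁ * E.transpose + E₁ * Q₁) ∧
        IsUnit (E.transpose * P₂ + Q₂ * E₂) ∧
        K = R₁ * (P₁ * E.transpose + E₁ * Q₁)⁻¹ ∧
        L = (E.transpose * P₂ + Q₂ * E₂)⁻¹ * R₂) := by
  have hr₁ : E.rank + E₁.rank = Fintype.card (Fin n) := by rw [Fintype.card_fin]; omega
  have hr₂ : E.rank + E₂.rank = Fintype.card (Fin n) := by rw [Fintype.card_fin]; omega
  have hE₁' : E₁.rank = Fintype.card (Fin (n - r)) := by rw [Fintype.card_fin, hE₁]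
  have hE₂' : E₂.rank = Fintype.card (Fin (n - r)) := by rw [Fintype.card_fin, hE₂]
  have hr : E.rank + Fintype.card (Fin (n - r)) = Fintype.card (Fin n) := by rw [← hE₁', hr₁]
  have hsplit : ∀ (K : Matrix (Fin m) (Fin n) ℝ) (L : Matrix (Fin n) (Fin p) ℝ),
      Admissible α (augE E) (augA A B C K L) ↔
        Admissible α E (A + B * K) ∧ Admissible α E (A + L * C) :=
    fun K L ↦ admissible_fromBlocks_iff
  refine ⟨?_, fun K L ↦ ?_⟩
  -- `K` and `L` enter different diagonal blocks, so the two design problems decouple.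
  · simp only [hsplit]
    rw [← exists_and_exists_comm, exists_admissible_add_mul_iff hα0 hα1 hEE₁ hE₂E hE₁' hE₂' hr,
      exists_admissible_add_mul_right_iff hα0 hα1 hEE₁ hE₂E hE₁' hE₂' hr]
    constructor
    · rintro ⟨⟨P₁, hP₁, Q₁, R₁, h₁⟩, P₂, hP₂, Q₂, R₂, h₂⟩
      exact ⟨P₁, hP₁, P₂, hP₂, Q₁, Q₂, R₁, R₂, h₁, h₂⟩
    · rintro ⟨P₁, hP₁, P₂, hP₂, Q₁, Q₂, R₁, R₂, h₁, h₂⟩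
      exact ⟨⟨P₁, hP₁, Q₁, R₁, h₁⟩, P₂, hP₂, Q₂, R₂, h₂⟩
  · rw [hsplit, admissible_add_mul_iff hα0 hα1 hEE₁ hr₁,
      admissible_add_mul_right_iff hα0 hα1 hE₂E hr₂]
    constructor
    · rintro ⟨⟨P₁, hP₁, Q₁, R₁, h₁, u₁, k₁⟩, P₂, hP₂, Q₂, R₂, h₂, u₂, k₂⟩
      exact ⟨P₁, hP₁, P₂, hP₂, Q₁, Q₂, R₁, R₂, h₁, h₂, u₁, u₂, k₁, k₂⟩
    · rintro ⟨P₁, hP₁, P₂, hP₂, Q₁, Q₂, R₁, R₂, h₁, h₂, u₁, u₂, k₁, k₂⟩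
      exact ⟨⟨P₁, hP₁, Q₁, R₁, h₁, u₁, k₁⟩, P₂, hP₂, Q₂, R₂, h₂, u₂, k₂⟩
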